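/- **Proposition 2.5.** Let $\mathbb T=\mathbb R/2\pi\mathbb Z$ and let $L^2_{\rm per,s}$ be the space of complex-valued $f\in L^2(\mathbb T\times\mathbb T)$ with $f(-x,y)=f(x,y)$ and $f(x,-y)=f(x,y)$ for a.e. $(x,y)$; put $H^r_{\rm per,s}=H^r(\mathbb T\times\mathbb T)\cap L^2_{\rm per,s}$. Fix $c>2$. Let $\varphi\in H^2_{\rm per,s}$ be a periodic minimizer, that is, a real-valued function, identified with its continuous representative, such that $\varphi>0$ on $\mathbb T\times\mathbb T$, $\varphi$ solves $$-\Delta\varphi+c\varphi-\varphi^2=0,$$ and, with $\lambda=\int_{\mathbb T\times\mathbb T}\varphi^3\,dx\,dy$, $\varphi$ minimizes $$B_c(u)=\frac12\int_{\mathbb T\times\mathbb T}\big(|\nabla u|^2+c|u|^2\big)\,dx\,dy$$ over the set $Y_\lambda$ of all complex-valued $u\in H^1_{\rm per,s}$ with $\int_{\mathbb T\times\mathbb T}|u|^3\,dx\,dy=\lambda$. Consider the operators $$\mathcal L_1=-\Delta+c-2\varphi,\qquad \mathcal L_2=-\Delta+c-\varphi$$ in $L^2_{\rm per,s}$ with domain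 $H^2_{\rm per,s}$, and $\mathcal L=\mathrm{diag}(\mathcal L_1,\mathcal L_2)$ in $L^2_{\rm per,s}\times L^2_{\rm per,s}$. For an operator $\mathcal A$ let $n(\mathcal A)$ be the number of its negative eigenvalues, counted with multiplicity, and $z(\mathcal A)$ the dimension of its kernel. Then $$n(\mathcal L_1)=n(\mathcal L)=1,\qquad n(\mathcal L_2)=0,\qquad z(\mathcal L_2)=1,$$ and $\operatorname{Ker}(\mathcal L_2)=\operatorname{span}\{\varphi\}$. -/

import Mathlib

noncomputable section

namespace PeriodicNLS

open MeasureTheory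

instance factTwoPiPos : Fact (0 < 2 * Real.pi) := ⟨Real.two_pi_pos⟩

/-- The circle of length `2π`. -/
abbrev Circ : Type := AddCircle (2 * Real.pi)

/-- The bi-torus, with the measure `dx dy` of total mass `4π²`. -/
abbrev Torus : Type := Circ × Circ

/-- Complex `L²` on the bi-torus. -/
abbrev L2 : Type := Lp ℂ 2 (volume : Measure Torus)

/-! ### Fourier series -/

/-- The exponential `(x, y) ↦ exp (i (k x + j y))`, for `m = (k, j)`. -/
def expo (m : ℤ × ℤ) : C(Torus, ℂ) where
  toFun z := fourier m.1 z.1 * fourier m.2 z.2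
  continuous_toFun := by fun_prop

/-- The exponential as an element of `L²`. -/
def expoL2 (m : ℤ × ℤ) : L2 := ContinuousMap.toLp 2 volume ℂ (expo m)

/-- The Fourier coefficient `(4π²)⁻¹ ∫ u(x,y) exp (-i (k x + j y)) dx dy`. -/
def coef (u : L2) (m : ℤ × ℤ) : ℂ :=
  (4 * Real.pi ^ 2 : ℂ)⁻¹ * ∫ z, expo (-m) z * u z

/-- `k² + j²`. -/
def freqSq (m : ℤ × ℤ) : ℝ := (m.1 : ℝ) ^ 2 + (m.2 : ℝ) ^ 2

lemma freqSq_nonneg (m : ℤ × ℤ) : 0 ≤ freqSq m := by unfold freqSq; positivity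

lemma integrable_expo_mul (m : ℤ × ℤ) (u : L2) :
    Integrable (fun z => expo m z * u z) (volume : Measure Torus) := by
  have hu : Integrable (u : Torus → ℂ) volume := (Lp.memLp u).integrable (by norm_num)
  refine hu.bdd_mul (c := ‖expo m‖) (expo m).continuous.aestronglyMeasurable ?_
  exact Filter.Eventually.of_forall fun z => (expo m).norm_coe_le_norm z

lemma coef_add (u v : L2) (m : ℤ × ℤ) : coef (u + v) m = coef u m + coef v m := by
  unfold coef
  rw [← mul_add, ← integral_add (integrable_expo_mul _ u) (integrable_expo_mul _ v)]
  congr 1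
  refine integral_congr_ae ?_
  filter_upwards [Lp.coeFn_add u v] with z hz
  rw [hz, Pi.add_apply, mul_add]

lemma coef_smul (a : ℂ) (u : L2) (m : ℤ × ℤ) : coef (a • u) m = a * coef u m := by
  have h : ∫ z, expo (-m) z * (a • u : L2) z = a * ∫ z, expo (-m) z * u z := by
    rw [← integral_const_mul]
    refine integral_congr_ae ?_
    filter_upwards [Lp.coeFn_smul a u] with z hz
    rw [hz, Pi.smul_apply, smul_eq_mul, mul_left_comm]
  unfold coef
  rw [h, mul_left_comm]

lemma integral_fourier (n : ℤ) (hn : n ≠ 0) :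
    ∫ x : Circ, (fourier n x : ℂ) = 0 := by
  exact integral_eq_zero_of_add_right_eq_neg
    (μ := (volume : Measure Circ)) (f := fun x : Circ => (fourier n x : ℂ))
    (fourier_add_half_inv_index hn Real.two_pi_pos)

lemma inner_expoL2 (m n : ℤ × ℤ) :
    inner ℂ (expoL2 m) (expoL2 n) = ∫ z : Torus, expo (n - m) z := by
  rw [expoL2, expoL2, ContinuousMap.inner_toLp]
  refine integral_congr_ae (Filter.Eventually.of_forall fun z => ?_)
  simp only [expo, ContinuousMap.coe_mk, map_mul, ← fourier_neg, sub_eq_add_neg,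
    Prod.fst_add, Prod.snd_add, Prod.fst_neg, Prod.snd_neg, fourier_add]
  ring

lemma integral_expo (m : ℤ × ℤ) (hm : m ≠ 0) : ∫ z : Torus, expo m z = 0 := by
  have h : ∫ z : Torus, expo m z = (∫ x : Circ, fourier m.1 x) * ∫ y : Circ, fourier m.2 y :=
    integral_prod_mul (fun x : Circ => fourier m.1 x) (fun y : Circ => fourier m.2 y)
  rw [h]
  by_cases h1 : m.1 = 0
  · have h2 : m.2 ≠ 0 := fun h2 => hm (Prod.ext h1 h2)
    rw [integral_fourier _ h2, mul_zero]
  · rw [integral_fourier _ h1, zero_mul]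

lemma norm_expoL2 (m : ℤ × ℤ) : ‖expoL2 m‖ = 2 * Real.pi := by
  have h : inner ℂ (expoL2 m) (expoL2 m) = ((2 * Real.pi) * (2 * Real.pi) : ℂ) := by
    rw [inner_expoL2, sub_self]
    have h : ∫ z : Torus, expo 0 z = (∫ x : Circ, fourier 0 x) * ∫ y : Circ, fourier 0 y :=
      integral_prod_mul (fun x : Circ => fourier 0 x) (fun y : Circ => fourier 0 y)
    rw [h]
    simp [Measure.real, AddCircle.measure_univ, Real.pi_pos.le]
  rw [inner_self_eq_norm_sq_to_K] at h
  have h2 : ‖expoL2 m‖ ^ 2 = (2 * Real.pi) ^ 2 := by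
    have : ((‖expoL2 m‖ ^ 2 : ℝ) : ℂ) = (((2 * Real.pi) ^ 2 : ℝ) : ℂ) := by
      push_cast; rw [sq (2 * (Real.pi : ℂ))]; exact h
    exact_mod_cast this
  exact (sq_eq_sq₀ (norm_nonneg _) (by positivity)).1 h2

/-- The exponentials, normalized. -/
lemma orthonormal_expo : Orthonormal ℂ fun m => ((2 * Real.pi : ℂ)⁻¹) • expoL2 m := by
  constructor
  · intro m
    rw [norm_smul, norm_expoL2]
    have : ‖(2 * Real.pi : ℂ)⁻¹‖ = (2 * Real.pi)⁻¹ := by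
      simp [abs_of_pos Real.pi_pos]
    rw [this, inv_mul_cancel₀ (by positivity)]
  · intro m n hmn
    rw [inner_smul_left, inner_smul_right, inner_expoL2,
      integral_expo _ (sub_ne_zero.2 hmn.symm), mul_zero, mul_zero]

lemma summable_expo {a : ℤ × ℤ → ℂ} (ha : Summable fun m => ‖a m‖ ^ 2) :
    Summable fun m => a m • expoL2 m := by
  have hs : Summable fun m => ‖(2 * Real.pi : ℂ) * a m‖ ^ 2 := by
    refine (ha.mul_left (‖(2 * Real.pi : ℂ)‖ ^ 2)).congr fun m => ?_
    rw [norm_mul _ (a m), mul_pow]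
  have h := (orthonormal_expo.orthogonalFamily.summable_iff_norm_sq_summable
    (fun m => (2 * Real.pi : ℂ) * a m)).2 hs
  have hpi : (2 * Real.pi : ℂ) ≠ 0 := by exact_mod_cast Real.two_pi_pos.ne'
  refine h.congr fun m => ?_
  rw [LinearIsometry.toSpanSingleton_apply, smul_smul, mul_right_comm, mul_inv_cancel₀ hpi,
    one_mul]

/-! ### Sobolev spaces and differential operators -/

/-- The periodic Sobolev space `H^r`, `r ∈ ℕ`:
all `u ∈ L²` with `∑ (1 + k² + j²)^r |û(k,j)|² < ∞`. -/
def Hper (r : ℕ) : Submodule ℂ L2 where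
  carrier := {u | Summable fun m => (1 + freqSq m) ^ r * ‖coef u m‖ ^ 2}
  zero_mem' := by
    have h : ∀ m, coef 0 m = 0 := fun m => by simpa using coef_smul 0 0 m
    simp [h]
  add_mem' := by
    intro u v hu hv
    refine Summable.of_nonneg_of_le (fun m => ?_) (fun m => ?_)
      ((Summable.add hu hv).mul_left 2)
    · have := freqSq_nonneg m; positivity
    · rw [coef_add, ← mul_add, mul_left_comm]
      have h0 := freqSq_nonneg m
      refine mul_le_mul_of_nonneg_left ?_ (by positivity)
      have h1 := norm_add_le (coef u m) (coef v m)
      nlinarith [norm_nonneg (coef u m + coef v m), sq_nonneg (‖coef u m‖ - ‖coef v m‖)]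
  smul_mem' := by
    intro a u hu
    refine (Summable.mul_left (‖a‖ ^ 2) hu).congr fun m => ?_
    rw [coef_smul, norm_mul, mul_pow]; ring

/-- `∂u/∂x`, for `u ∈ H¹`. -/
def dx (u : L2) : L2 := ∑' m : ℤ × ℤ, (Complex.I * m.1 * coef u m) • expoL2 m

/-- `∂u/∂y`, for `u ∈ H¹`. -/
def dy (u : L2) : L2 := ∑' m : ℤ × ℤ, (Complex.I * m.2 * coef u m) • expoL2 m

/-- `-Δu`, for `u ∈ H²`. -/
def negLap (u : L2) : L2 := ∑' m : ℤ × ℤ, ((freqSq m : ℂ) * coef u m) • expoL2 m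

/-- The series that defines `-Δu` converges in `L²` for `u ∈ H²`. -/
lemma summable_negLap {u : L2} (hu : u ∈ Hper 2) :
    Summable fun m : ℤ × ℤ => ((freqSq m : ℂ) * coef u m) • expoL2 m := by
  refine summable_expo (Summable.of_nonneg_of_le (fun m => by positivity) (fun m => ?_) hu)
  have h0 := freqSq_nonneg m
  rw [norm_mul, mul_pow, Complex.norm_real, Real.norm_of_nonneg h0]
  gcongr
  linarith

/-- The series that defines `∂u/∂x` converges in `L²` for `u ∈ H¹`. -/
lemma summable_dx {u : L2} (hu : u ∈ Hper 1) :
    Summable fun m : ℤ × ℤ => (Complex.I * m.1 * coef u m) • expoL2 m := by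
  refine summable_expo (Summable.of_nonneg_of_le (fun m => by positivity) (fun m => ?_) hu)
  rw [norm_mul, norm_mul, Complex.norm_I, one_mul, mul_pow, pow_one, Complex.norm_intCast, sq_abs]
  gcongr
  unfold freqSq
  nlinarith [sq_nonneg (m.2 : ℝ)]

/-- The series that defines `∂u/∂y` converges in `L²` for `u ∈ H¹`. -/
lemma summable_dy {u : L2} (hu : u ∈ Hper 1) :
    Summable fun m : ℤ × ℤ => (Complex.I * m.2 * coef u m) • expoL2 m := by
  refine summable_expo (Summable.of_nonneg_of_le (fun m => by positivity) (fun m => ?_) hu)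
  rw [norm_mul, norm_mul, Complex.norm_I, one_mul, mul_pow, pow_one, Complex.norm_intCast, sq_abs]
  gcongr
  unfold freqSq
  nlinarith [sq_nonneg (m.1 : ℝ)]

/-! ### The symmetric sector -/

/-- `(x, y) ↦ (-x, y)`. -/
def reflX (z : Torus) : Torus := (-z.1, z.2)

/-- `(x, y) ↦ (x, -y)`. -/
def reflY (z : Torus) : Torus := (z.1, -z.2)

lemma measurePreserving_reflX : MeasurePreserving reflX (volume : Measure Torus) volume :=
  (Measure.measurePreserving_neg (volume : Measure Circ)).prod
    (MeasurePreserving.id (volume : Measure Circ))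

lemma measurePreserving_reflY : MeasurePreserving reflY (volume : Measure Torus) volume :=
  (MeasurePreserving.id (volume : Measure Circ)).prod
    (Measure.measurePreserving_neg (volume : Measure Circ))

/-- The functions of `L²` that are almost everywhere invariant under `σ`. -/
def invariantUnder (σ : Torus → Torus)
    (hσ : MeasurePreserving σ (volume : Measure Torus) volume) : Submodule ℂ L2 where
  carrier := {u | ∀ᵐ z : Torus, u (σ z) = u z}
  zero_mem' := by
    have h := Lp.coeFn_zero ℂ 2 (volume : Measure Torus)
    show ∀ᵐ z : Torus, _
    filter_upwards [h, hσ.quasiMeasurePreserving.ae h] with z h1 h2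
    rw [h1, h2]; rfl
  add_mem' := by
    intro u v hu hv
    have h := Lp.coeFn_add u v
    show ∀ᵐ z : Torus, _
    filter_upwards [h, hσ.quasiMeasurePreserving.ae h, hu, hv] with z h1 h2 h3 h4
    rw [h1, h2, Pi.add_apply, Pi.add_apply, h3, h4]
  smul_mem' := by
    intro a u hu
    have h := Lp.coeFn_smul a u
    show ∀ᵐ z : Torus, _
    filter_upwards [h, hσ.quasiMeasurePreserving.ae h, hu] with z h1 h2 h3
    rw [h1, h2, Pi.smul_apply, Pi.smul_apply, h3]

/-- `L²_{per,s}`: the `u ∈ L²` with `u(-x,y) = u(x,y)` and `u(x,-y) = u(x,y)` a.e. -/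
def L2s : Submodule ℂ L2 :=
  invariantUnder reflX measurePreserving_reflX ⊓ invariantUnder reflY measurePreserving_reflY

/-- `H^r_{per,s}`. -/
def Hs (r : ℕ) : Submodule ℂ L2 := Hper r ⊓ L2s

lemma mem_invariantUnder_iff {σ : Torus → Torus}
    (hσ : MeasurePreserving σ (volume : Measure Torus) volume) {u : L2} :
    u ∈ invariantUnder σ hσ ↔ Lp.compMeasurePreservingₗᵢ ℂ σ hσ u = u := by
  have h := Lp.coeFn_compMeasurePreserving u hσ
  constructor
  · intro hu
    refine Lp.ext ?_
    change ∀ᵐ z : Torus, u (σ z) = u z at hu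
    filter_upwards [h, hu] with z h1 h2
    exact h1.trans h2
  · intro hu
    show ∀ᵐ z : Torus, u (σ z) = u z
    have hu' : Lp.compMeasurePreserving σ hσ u = u := hu
    rw [hu'] at h
    filter_upwards [h] with z h1
    exact h1.symm

/-- If `σ` permutes the frequencies by `s`, then a Fourier multiplier that is constant along `s`
preserves the functions invariant under `σ`. -/
lemma negLap_mem_invariantUnder {σ : Torus → Torus}
    (hσ : MeasurePreserving σ (volume : Measure Torus) volume) (s : ℤ × ℤ ≃ ℤ × ℤ)
    (hs : ∀ m z, expo m (σ z) = expo (s m) z) (hneg : ∀ m, s (-m) = -s m)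
    (hf : ∀ m, freqSq (s m) = freqSq m)
    {u : L2} (hu : u ∈ Hper 2) (hinv : u ∈ invariantUnder σ hσ) :
    negLap u ∈ invariantUnder σ hσ := by
  have hc : ∀ m, coef u (s m) = coef u m := by
    intro m
    unfold coef
    congr 1
    have h1 : ∫ z, expo (-m) (σ z) * u (σ z) = ∫ z, expo (-m) z * u z := by
      have hmap := integral_map (μ := (volume : Measure Torus)) (φ := σ)
        hσ.measurable.aemeasurable (f := fun z => expo (-m) z * u z)
        (by rw [hσ.map_eq]; exact (integrable_expo_mul _ u).aestronglyMeasurable)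
      rw [hσ.map_eq] at hmap
      exact hmap.symm
    rw [← h1]
    refine integral_congr_ae ?_
    change ∀ᵐ z : Torus, u (σ z) = u z at hinv
    filter_upwards [hinv] with z hz
    rw [hz, hs, hneg]
  have he : ∀ m, Lp.compMeasurePreservingₗᵢ ℂ σ hσ (expoL2 m) = expoL2 (s m) := by
    intro m
    refine Lp.ext ?_
    have h1 := Lp.coeFn_compMeasurePreserving (expoL2 m) hσ
    have h2 := hσ.quasiMeasurePreserving.ae
      (ContinuousMap.coeFn_toLp (p := 2) (𝕜 := ℂ) (volume : Measure Torus) (expo m))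
    have h3 := ContinuousMap.coeFn_toLp (p := 2) (𝕜 := ℂ) (volume : Measure Torus) (expo (s m))
    filter_upwards [h1, h2, h3] with z h1 h2 h3
    refine h1.trans (h2.trans ?_)
    rw [hs]
    exact h3.symm
  rw [mem_invariantUnder_iff]
  have h := (summable_negLap hu).map_tsum
    (Lp.compMeasurePreservingₗᵢ ℂ σ hσ) (Lp.compMeasurePreservingₗᵢ ℂ σ hσ).continuous
  unfold negLap
  rw [h, ← Equiv.tsum_eq s fun m => ((freqSq m : ℂ) * coef u m) • expoL2 m]
  refine tsum_congr fun m => ?_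
  rw [map_smul, he, hf, hc]

lemma negLap_mem_L2s {u : L2} (hu : u ∈ Hs 2) : negLap u ∈ L2s := by
  obtain ⟨h2, hx, hy⟩ := hu
  refine ⟨negLap_mem_invariantUnder _ (Equiv.prodCongr (Equiv.neg ℤ) (Equiv.refl ℤ)) ?_ ?_ ?_ h2 hx,
    negLap_mem_invariantUnder _ (Equiv.prodCongr (Equiv.refl ℤ) (Equiv.neg ℤ)) ?_ ?_ ?_ h2 hy⟩
  · intro m z; simp [expo, reflX, fourier_apply]
  · intro m; ext <;> simp
  · intro m; simp [freqSq]
  · intro m z; simp [expo, reflY, fourier_apply]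
  · intro m; ext <;> simp
  · intro m; simp [freqSq]

/-! ### Multiplication by a continuous real function -/

/-- A continuous real function as an element of complex `L²`. -/
def toL2 (φ : C(Torus, ℝ)) : L2 :=
  ContinuousMap.toLp 2 volume ℂ (ContinuousMap.comp ⟨Complex.ofReal, Complex.continuous_ofReal⟩ φ)

lemma coeFn_toL2 (φ : C(Torus, ℝ)) : ∀ᵐ z : Torus, toL2 φ z = (φ z : ℂ) :=
  ContinuousMap.coeFn_toLp (p := 2) (𝕜 := ℂ) (volume : Measure Torus) _

lemma memLp_mul (φ : C(Torus, ℝ)) (u : L2) :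
    MemLp (fun z : Torus => (φ z : ℂ) * u z) 2 volume := by
  refine MemLp.of_le_mul (c := ‖φ‖) (Lp.memLp u) ?_ ?_
  · exact (Complex.continuous_ofReal.comp φ.continuous).aestronglyMeasurable.mul
      (Lp.aestronglyMeasurable u)
  · refine Filter.Eventually.of_forall fun z => ?_
    rw [norm_mul, Complex.norm_real]
    exact mul_le_mul_of_nonneg_right (φ.norm_coe_le_norm z) (norm_nonneg _)

/-- The pointwise product `φ u`. -/
def mulBy (φ : C(Torus, ℝ)) : L2 →ₗ[ℂ] L2 where
  toFun u := (memLp_mul φ u).toLp _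
  map_add' u v := by
    rw [← MemLp.toLp_add]
    refine MemLp.toLp_congr _ _ ?_
    filter_upwards [Lp.coeFn_add u v] with z hz
    rw [hz]
    simp [mul_add]
  map_smul' a u := by
    rw [RingHom.id_apply, ← MemLp.toLp_const_smul]
    refine MemLp.toLp_congr _ _ ?_
    filter_upwards [Lp.coeFn_smul a u] with z hz
    rw [hz]
    simp [mul_left_comm]

lemma coeFn_mulBy (φ : C(Torus, ℝ)) (u : L2) : ∀ᵐ z : Torus, mulBy φ u z = (φ z : ℂ) * u z :=
  MemLp.coeFn_toLp (memLp_mul φ u)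

lemma mulBy_mem_invariantUnder {σ : Torus → Torus}
    (hσ : MeasurePreserving σ (volume : Measure Torus) volume) {φ : C(Torus, ℝ)}
    (hφ : toL2 φ ∈ invariantUnder σ hσ) {u : L2} (hu : u ∈ invariantUnder σ hσ) :
    mulBy φ u ∈ invariantUnder σ hσ := by
  change ∀ᵐ z : Torus, _ at hφ
  change ∀ᵐ z : Torus, _ at hu
  show ∀ᵐ z : Torus, _
  have h1 := coeFn_mulBy φ u
  have h2 := coeFn_toL2 φ
  filter_upwards [h1, hσ.quasiMeasurePreserving.ae h1, h2, hσ.quasiMeasurePreserving.ae h2, hφ, hu]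
    with z a1 a2 a3 a4 a5 a6
  rw [a1, a2, ← a3, ← a4, a5, a6]

/-! ### The linearized operators -/

/-- `-Δ` as a linear map on `H²`. -/
def negLapₗ : Hper 2 →ₗ[ℂ] L2 where
  toFun u := negLap u
  map_add' u v := by
    unfold negLap
    rw [← (summable_negLap u.2).tsum_add (summable_negLap v.2)]
    refine tsum_congr fun m => ?_
    rw [Submodule.coe_add, coef_add, mul_add, add_smul]
  map_smul' a u := by
    unfold negLap
    rw [RingHom.id_apply, ← (summable_negLap u.2).tsum_const_smul a]
    refine tsum_congr fun m => ?_
    rw [Submodule.coe_smul, coef_smul, smul_smul, mul_left_comm]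

/-- The operator `-Δ + c - a φ` in `L²_{per,s}` with domain `H²_{per,s}`, for a continuous
`φ` in `L²_{per,s}`. -/
def schrodinger (c a : ℝ) (φ : C(Torus, ℝ)) (hφ : toL2 φ ∈ L2s) : L2s →ₗ.[ℂ] L2s where
  domain := (Hs 2).comap L2s.subtype
  toFun := LinearMap.codRestrict L2s
    (negLapₗ.comp ((L2s.subtype.comp ((Hs 2).comap L2s.subtype).subtype).codRestrict (Hper 2)
        fun u => u.2.1)
      + ((c : ℂ) • LinearMap.id - (a : ℂ) • mulBy φ).comp
        (L2s.subtype.comp ((Hs 2).comap L2s.subtype).subtype))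
    fun u => L2s.add_mem (negLap_mem_L2s u.2)
      (L2s.sub_mem (L2s.smul_mem _ u.1.2) (L2s.smul_mem _
        ⟨mulBy_mem_invariantUnder _ hφ.1 u.1.2.1, mulBy_mem_invariantUnder _ hφ.2 u.1.2.2⟩))

lemma schrodinger_apply (c a : ℝ) (φ : C(Torus, ℝ)) (hφ : toL2 φ ∈ L2s)
    (u : (schrodinger c a φ hφ).domain) :
    (schrodinger c a φ hφ u : L2) =
      negLap (u : L2s) + ((c : ℂ) • ((u : L2s) : L2) - (a : ℂ) • mulBy φ (u : L2s)) := rfl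

/-- `𝓛₁ = -Δ + c - 2φ`. -/
def opL₁ (c : ℝ) (φ : C(Torus, ℝ)) (hφ : toL2 φ ∈ L2s) : L2s →ₗ.[ℂ] L2s :=
  schrodinger c 2 φ hφ

/-- `𝓛₂ = -Δ + c - φ`. -/
def opL₂ (c : ℝ) (φ : C(Torus, ℝ)) (hφ : toL2 φ ∈ L2s) : L2s →ₗ.[ℂ] L2s :=
  schrodinger c 1 φ hφ

/-- The block diagonal operator `diag(A, B)`. -/
def blockDiag {E F : Type*} [AddCommGroup E] [Module ℂ E] [AddCommGroup F] [Module ℂ F]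
    (A : E →ₗ.[ℂ] E) (B : F →ₗ.[ℂ] F) : E × F →ₗ.[ℂ] E × F where
  domain := A.domain.prod B.domain
  toFun := LinearMap.prod
    (A.toFun.comp (((LinearMap.fst ℂ E F).comp (A.domain.prod B.domain).subtype).codRestrict
      A.domain fun w => w.2.1))
    (B.toFun.comp (((LinearMap.snd ℂ E F).comp (A.domain.prod B.domain).subtype).codRestrict
      B.domain fun w => w.2.2))

lemma blockDiag_apply {E F : Type*} [AddCommGroup E] [Module ℂ E] [AddCommGroup F] [Module ℂ F]
    (A : E →ₗ.[ℂ] E) (B : F →ₗ.[ℂ] F) (w : (blockDiag A B).domain) :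
    blockDiag A B w = (A ⟨(w : E × F).1, w.2.1⟩, B ⟨(w : E × F).2, w.2.2⟩) := rfl

/-- `𝓛 = diag(𝓛₁, 𝓛₂)`. -/
def opL (c : ℝ) (φ : C(Torus, ℝ)) (hφ : toL2 φ ∈ L2s) : L2s × L2s →ₗ.[ℂ] L2s × L2s :=
  blockDiag (opL₁ c φ hφ) (opL₂ c φ hφ)

/-! ### Counting eigenvalues -/

section Counting

variable {E : Type*} [AddCommGroup E] [Module ℂ E]

/-- The eigenspace `{u ∈ D(A) : A u = μ u}` of an operator `A` with domain `D(A)`. -/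
def eigenspace (A : E →ₗ.[ℂ] E) (μ : ℝ) : Submodule ℂ E :=
  (LinearMap.ker (A.toFun - (μ : ℂ) • A.domain.subtype)).map A.domain.subtype

lemma mem_eigenspace (A : E →ₗ.[ℂ] E) (μ : ℝ) (u : E) :
    u ∈ eigenspace A μ ↔ ∃ h : u ∈ A.domain, A ⟨u, h⟩ = (μ : ℂ) • u := by
  constructor
  · rintro ⟨v, hv, rfl⟩
    exact ⟨v.2, sub_eq_zero.1 hv⟩
  · rintro ⟨h, hu⟩
    exact ⟨⟨u, h⟩, sub_eq_zero.2 hu, rfl⟩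

/-- `n(A)`: the number of negative eigenvalues of `A`, counted with multiplicity (the sum over
`μ < 0` of the dimensions of the eigenspaces). As eigenspaces are linearly independent, the sum is
the dimension of their span. -/
def negCount (A : E →ₗ.[ℂ] E) : Cardinal :=
  Module.rank ℂ (⨆ μ : {μ : ℝ // μ < 0}, eigenspace A (μ : ℝ) : Submodule ℂ E)

/-- `z(A)`: the dimension of the kernel of `A`. -/
def kerDim (A : E →ₗ.[ℂ] E) : Cardinal := Module.rank ℂ (eigenspace A 0)

end Counting

/-! ### The periodic minimizer -/

/-- `B_c(u) = ½ ∫ |∇u|² + c |u|²`. -/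
def energyB (c : ℝ) (u : L2) : ℝ :=
  (1 / 2) * ∫ z : Torus, (‖dx u z‖ ^ 2 + ‖dy u z‖ ^ 2 + c * ‖u z‖ ^ 2)

/-- `Y_lam = {u ∈ H¹_{per,s} : ∫ |u|³ = lam}` (complex-valued functions). -/
def constraintSet (lam : ℝ) : Set L2 :=
  {u | u ∈ Hs 1 ∧ ∫ z : Torus, ‖u z‖ ^ 3 = lam}

/-- `φ` is a periodic minimizer with frequency `c`: a positive real function in `H²_{per,s}`
that solves `-Δφ + cφ - φ² = 0` and minimizes `B_c` over `Y_lam`, where `lam = ∫ φ³`. Elements of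
`H²` of the bi-torus have a continuous representative, and `φ` stands for it. -/
structure IsPeriodicMinimizer (c : ℝ) (φ : C(Torus, ℝ)) : Prop where
  pos : ∀ z, 0 < φ z
  mem_Hs : toL2 φ ∈ Hs 2
  equation : negLap (toL2 φ) + (c : ℂ) • toL2 φ - toL2 (φ ^ 2) = 0
  minimizes : ∃ lam : ℝ, toL2 φ ∈ constraintSet lam ∧ IsMinOn (energyB c) (constraintSet lam) (toL2 φ)

lemma IsPeriodicMinimizer.mem_L2s {c : ℝ} {φ : C(Torus, ℝ)} (h : IsPeriodicMinimizer c φ) :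
    toL2 φ ∈ L2s := h.mem_Hs.2

end PeriodicNLS

end

open PeriodicNLS

noncomputable section

namespace PeriodicNLS

open MeasureTheory Filter Topology ComplexConjugate

/-! ### Completeness of the exponentials -/

/-! The form of `𝓛₂` is governed by its ground state. The equation says `𝓛₂ φ = 0`, and for `f` in
`H²` the substitution `v = f / φ` formally gives `(f, 𝓛₂ f) = ∫ φ² |∇v|²`. So the form is
nonnegative, and it vanishes only if `v` is constant: there are no negative eigenvalues and the
kernel is spanned by `φ`. To avoid differentiating `|f|² / φ`, the gradient identity is replaced by
a finite-difference one, which is algebra on two values (`picone`). The step then tends to `0` on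
the Fourier side (`tendsto_discrete`). What remains is `ground_state_le`: the form dominates the
gradient energy of each single Fourier mode of `v`, up to the factor `min φ ²`. This suffices for
`form_nonneg` and `eq_smul`.

For `𝓛₁`, minimality gives at most one negative eigenvalue. Perturb `φ` by a real `t v` with `∫ φ² v
= 0`, rescale back onto the constraint, and compare energies at order `t²`: this yields `(v, 𝓛₁ v) ≥
0` (`second_variation_real`). The form splits over real and imaginary parts, so it is nonnegative on
the whole complex hyperplane orthogonal to `φ²` (`second_variation`). It is negative definite on the
span of the eigenvectors with negative eigenvalue, so that span meets the hyperplane trivially and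
has dimension at most one (`negCount_le_one`).

At least one negative eigenvalue exists because `(φ, 𝓛₁ φ) = -∫ φ³ < 0`. A large shift of `𝓛₁` has a
compact symmetric inverse; were there no negative eigenvalue, the spectral theorem for that inverse
would make the form nonnegative (`exists_neg_eigenspace_ne_bot`).

Finally, the negative eigenspaces of the block operator are those of `𝓛₁`, since `𝓛₂` has none. -/

lemma expo_add (m n : ℤ × ℤ) : expo (m + n) = expo m * expo n := by
  ext z
  simp only [expo, ContinuousMap.coe_mk, Prod.fst_add, Prod.snd_add, fourier_add,
    ContinuousMap.mul_apply]
  ring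

lemma expo_zero : expo 0 = 1 := by
  ext z
  simp [expo]

lemma expo_neg (m : ℤ × ℤ) (z : Torus) : expo (-m) z = conj (expo m z) := by
  simp [expo]

lemma norm_expo_apply (m : ℤ × ℤ) (z : Torus) : ‖expo m z‖ = 1 := by
  rw [expo, ContinuousMap.coe_mk, norm_mul, fourier_apply, fourier_apply, Circle.norm_coe,
    Circle.norm_coe, one_mul]

/-- The star subalgebra of `C(Torus, ℂ)` generated by the exponentials. -/
def expoSubalgebra : StarSubalgebra ℂ C(Torus, ℂ) where
  toSubalgebra := Algebra.adjoin ℂ (Set.range expo)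
  star_mem' := by
    change Algebra.adjoin ℂ (Set.range expo) ≤ star (Algebra.adjoin ℂ (Set.range expo))
    refine Algebra.adjoin_le ?_
    rintro _ ⟨n, rfl⟩
    refine Algebra.subset_adjoin ⟨-n, ?_⟩
    ext1 x
    simp only [expo_neg, starRingEnd_apply, ContinuousMap.star_apply]

/-- The exponentials are closed under products and contain `1`, so generating an algebra adds
nothing beyond linear combinations. -/
lemma expoSubalgebra_coe :
    expoSubalgebra.toSubalgebra.toSubmodule = Submodule.span ℂ (Set.range expo) := by
  apply Algebra.adjoin_eq_span_of_subset
  refine .trans (fun x ↦ Submonoid.closure_induction (fun _ ↦ id) ⟨0, expo_zero⟩ ?_)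
    Submodule.subset_span
  rintro _ _ _ _ ⟨m, rfl⟩ ⟨n, rfl⟩
  exact ⟨m + n, expo_add m n⟩

/-- The frequency-one character is injective on the circle, so the frequencies `(1, 0)` and `(0, 1)`
already separate points. -/
lemma expoSubalgebra_separatesPoints : expoSubalgebra.SeparatesPoints := by
  have key : ∀ a b : Circ, fourier 1 a = fourier 1 b → a = b := by
    intro a b h
    rw [fourier_one, fourier_one] at h
    replace h := Circle.ext h
    exact AddCircle.injective_toCircle Real.two_pi_pos.ne' h
  intro x y hxy
  by_cases h1 : x.1 = y.1
  · refine ⟨_, ⟨expo (0, 1), Algebra.subset_adjoin ⟨(0, 1), rfl⟩, rfl⟩, fun h => hxy ?_⟩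
    refine Prod.ext h1 (key _ _ ?_)
    simpa [expo] using h
  · refine ⟨_, ⟨expo (1, 0), Algebra.subset_adjoin ⟨(1, 0), rfl⟩, rfl⟩, fun h => h1 (key _ _ ?_)⟩
    simpa [expo] using h

lemma span_expo_closure_eq_top :
    (Submodule.span ℂ (Set.range expo)).topologicalClosure = ⊤ := by
  rw [← expoSubalgebra_coe]
  exact congr_arg (Subalgebra.toSubmodule <| StarSubalgebra.toSubalgebra ·)
    (ContinuousMap.starSubalgebra_topologicalClosure_eq_top_of_separatesPoints _
      expoSubalgebra_separatesPoints)

/-- Stone–Weierstrass gives density in the sup norm, which passes to `L²` because continuous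
functions have dense image there. -/
lemma span_expoL2_closure_eq_top :
    (Submodule.span ℂ (Set.range expoL2)).topologicalClosure = ⊤ := by
  have := (ContinuousMap.toLp_denseRange (p := 2) ℂ (volume : Measure Torus) ℂ
    (by simp)).topologicalClosure_map_submodule span_expo_closure_eq_top
  simpa only [Submodule.map_span, ContinuousLinearMap.coe_coe, ← Set.range_comp,
    Function.comp_def] using! this

lemma two_pi_ne_zero : (2 * Real.pi : ℂ) ≠ 0 := by exact_mod_cast Real.two_pi_pos.ne'

lemma four_pi_sq_ne_zero : (4 * Real.pi ^ 2 : ℂ) ≠ 0 := by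
  intro h
  exact pow_ne_zero 2 two_pi_ne_zero (by rw [← h]; ring)

/-- The normalized exponentials as a Hilbert basis of `L²`. -/
def expoBasis : HilbertBasis (ℤ × ℤ) ℂ L2 :=
  HilbertBasis.mk orthonormal_expo (by
    rw [← span_expoL2_closure_eq_top]
    refine Submodule.topologicalClosure_mono (Submodule.span_le.2 ?_)
    rintro _ ⟨m, rfl⟩
    have h : expoL2 m = (2 * Real.pi : ℂ) • ((2 * Real.pi : ℂ)⁻¹ • expoL2 m) := by
      rw [smul_smul, mul_inv_cancel₀ two_pi_ne_zero, one_smul]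
    rw [h]
    exact Submodule.smul_mem _ _ (Submodule.subset_span ⟨m, rfl⟩))

lemma inner_expoL2_left (m : ℤ × ℤ) (u : L2) :
    inner ℂ (expoL2 m) u = (4 * Real.pi ^ 2 : ℂ) * coef u m := by
  rw [coef, mul_inv_cancel_left₀ four_pi_sq_ne_zero, MeasureTheory.L2.inner_def]
  refine integral_congr_ae ?_
  filter_upwards [ContinuousMap.coeFn_toLp (p := 2) (𝕜 := ℂ) (volume : Measure Torus) (expo m)]
    with z hz
  rw [expoL2, hz, RCLike.inner_apply, expo_neg, mul_comm]

/-- **Parseval's identity** for inner products. -/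
lemma hasSum_inner (u v : L2) :
    HasSum (fun m => (4 * Real.pi ^ 2 : ℂ) * (conj (coef u m) * coef v m)) (inner ℂ u v) := by
  refine (expoBasis.hasSum_inner_mul_inner u v).congr_fun fun m => ?_
  have hb : expoBasis m = (2 * Real.pi : ℂ)⁻¹ • expoL2 m := by simp [expoBasis]
  rw [hb, ← inner_conj_symm u, inner_smul_left, inner_smul_left, inner_expoL2_left,
    inner_expoL2_left]
  have h1 : (conj (2 * Real.pi : ℂ)⁻¹) = (2 * Real.pi : ℂ)⁻¹ := by
    rw [show (2 * Real.pi : ℂ)⁻¹ = (((2 * Real.pi)⁻¹ : ℝ) : ℂ) by push_cast; rfl,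
      Complex.conj_ofReal]
  have h3 : (conj (4 * Real.pi ^ 2 : ℂ)) = 4 * Real.pi ^ 2 := by
    rw [show (4 * Real.pi ^ 2 : ℂ) = ((4 * Real.pi ^ 2 : ℝ) : ℂ) by push_cast; rfl,
      Complex.conj_ofReal]
  rw [map_mul, map_mul, h1, h1, h3]
  have h2 : (Real.pi : ℂ) ≠ 0 := by exact_mod_cast Real.pi_ne_zero
  field_simp
  ring

/-- **Parseval's identity** for norms. -/
lemma hasSum_norm_sq (u : L2) :
    HasSum (fun m => (4 * Real.pi ^ 2) * ‖coef u m‖ ^ 2) (‖u‖ ^ 2) := by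
  have h := Complex.hasSum_re (hasSum_inner u u)
  rw [← inner_self_eq_norm_sq (𝕜 := ℂ) u]
  refine h.congr_fun fun m => ?_
  rw [Complex.conj_mul']
  norm_cast

lemma summable_coef_sq (u : L2) : Summable fun m => ‖coef u m‖ ^ 2 := by
  refine ((hasSum_norm_sq u).summable.mul_left (4 * Real.pi ^ 2)⁻¹).congr fun m => ?_
  have := Real.pi_ne_zero
  field_simp

/-- Parseval applied to `u - v`. The operator identities below are checked coefficient by
coefficient through this lemma. -/
lemma ext_coef {u v : L2} (h : ∀ m, coef u m = coef v m) : u = v := by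
  have h0 : ∀ m, coef (u - v) m = 0 := fun m => by
    rw [sub_eq_add_neg, ← neg_one_smul ℂ v, coef_add, coef_smul, h]
    ring
  have h1 := hasSum_norm_sq (u - v)
  simp only [h0, norm_zero] at h1
  have h2 := h1.unique (by simp only [ne_eq, OfNat.ofNat_ne_zero, not_false_eq_true, zero_pow, mul_zero]; exact hasSum_zero)
  exact sub_eq_zero.1 (norm_eq_zero.1 (pow_eq_zero_iff two_ne_zero |>.1 h2))

lemma coef_sub (u v : L2) (m : ℤ × ℤ) : coef (u - v) m = coef u m - coef v m := by
  rw [sub_eq_add_neg, ← neg_one_smul ℂ v, coef_add, coef_smul]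
  ring

lemma coef_expoL2 (n m : ℤ × ℤ) : coef (expoL2 n) m = if n = m then 1 else 0 := by
  have h := inner_expoL2_left m (expoL2 n)
  split_ifs with hnm
  · subst hnm
    rw [inner_self_eq_norm_sq_to_K, norm_expoL2] at h
    refine mul_left_cancel₀ four_pi_sq_ne_zero (h.symm.trans ?_)
    push_cast
    simp
    ring
  · rw [inner_expoL2, integral_expo _ (sub_ne_zero.2 hnm)] at h
    exact (mul_eq_zero.1 h.symm).resolve_left four_pi_sq_ne_zero

lemma coef_eq_inner (u : L2) (m : ℤ × ℤ) :
    coef u m = (4 * Real.pi ^ 2 : ℂ)⁻¹ * inner ℂ (expoL2 m) u := by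
  rw [inner_expoL2_left, inv_mul_cancel_left₀ four_pi_sq_ne_zero]

/-- The Fourier coefficient as a continuous linear functional. -/
def coefCLM (m : ℤ × ℤ) : L2 →L[ℂ] ℂ := (4 * Real.pi ^ 2 : ℂ)⁻¹ • innerSL ℂ (expoL2 m)

lemma coefCLM_apply (m : ℤ × ℤ) (u : L2) : coefCLM m u = coef u m := by
  rw [coef_eq_inner]; rfl

lemma coef_tsum {a : ℤ × ℤ → ℂ} (ha : Summable fun m => a m • expoL2 m) (n : ℤ × ℤ) :
    coef (∑' m, a m • expoL2 m) n = a n := by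
  rw [← coefCLM_apply, (coefCLM n).map_tsum ha, tsum_eq_single n]
  · rw [map_smul, coefCLM_apply, coef_expoL2, if_pos rfl, smul_eq_mul, mul_one]
  · intro m hm
    rw [map_smul, coefCLM_apply, coef_expoL2, if_neg hm, smul_zero]

lemma mem_Hper {r : ℕ} {u : L2} :
    u ∈ Hper r ↔ Summable fun m => (1 + freqSq m) ^ r * ‖coef u m‖ ^ 2 := Iff.rfl

lemma Hper_two_le_one : Hper 2 ≤ Hper 1 := by
  intro u hu
  refine Summable.of_nonneg_of_le (fun m => ?_) (fun m => ?_) hu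
  · have := freqSq_nonneg m; positivity
  · have := freqSq_nonneg m
    gcongr
    · linarith
    · norm_num

lemma coef_negLap {u : L2} (hu : u ∈ Hper 2) (m : ℤ × ℤ) :
    coef (negLap u) m = freqSq m * coef u m := coef_tsum (summable_negLap hu) m

lemma coef_dx {u : L2} (hu : u ∈ Hper 1) (m : ℤ × ℤ) :
    coef (dx u) m = Complex.I * m.1 * coef u m := coef_tsum (summable_dx hu) m

lemma coef_dy {u : L2} (hu : u ∈ Hper 1) (m : ℤ × ℤ) :
    coef (dy u) m = Complex.I * m.2 * coef u m := coef_tsum (summable_dy hu) m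

lemma negLap_add {u v : L2} (hu : u ∈ Hper 2) (hv : v ∈ Hper 2) :
    negLap (u + v) = negLap u + negLap v := ext_coef fun m => by
  rw [coef_negLap (add_mem hu hv), coef_add, coef_add, coef_negLap hu, coef_negLap hv, mul_add]

lemma negLap_smul (a : ℂ) {u : L2} (hu : u ∈ Hper 2) :
    negLap (a • u) = a • negLap u := ext_coef fun m => by
  rw [coef_negLap (Submodule.smul_mem _ a hu), coef_smul, coef_smul, coef_negLap hu, mul_left_comm]

lemma negLap_symm {u v : L2} (hu : u ∈ Hper 2) (hv : v ∈ Hper 2) :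
    inner ℂ (negLap u) v = inner ℂ u (negLap v) := by
  refine (hasSum_inner _ _).unique ((hasSum_inner _ _).congr_fun fun m => ?_)
  rw [coef_negLap hu, coef_negLap hv, map_mul, Complex.conj_ofReal]
  ring

lemma integral_norm_sq (u : L2) : ∫ z, ‖u z‖ ^ 2 = ‖u‖ ^ 2 := by
  rw [← inner_self_eq_norm_sq (𝕜 := ℂ) u, MeasureTheory.L2.inner_def,
    ← integral_re (L2.integrable_inner u u)]
  refine integral_congr_ae (Eventually.of_forall fun z => ?_)
  simp only [inner_self_eq_norm_sq]

lemma integrable_norm_sq (u : L2) : Integrable (fun z => ‖u z‖ ^ 2) (volume : Measure Torus) :=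
  (Lp.memLp u).integrable_norm_pow (by norm_num)

/-- On `H²`, the energy is the quadratic form of `-Δ + c`. -/
lemma energyB_eq (c : ℝ) {u : L2} (hu : u ∈ Hper 2) :
    energyB c u = (1 / 2) * (inner ℂ u (negLap u + (c : ℂ) • u)).re := by
  have h1 := Hper_two_le_one hu
  unfold energyB
  have h2 : Integrable (fun z => ‖dx u z‖ ^ 2 + ‖dy u z‖ ^ 2) (volume : Measure Torus) :=
    (integrable_norm_sq _).add (integrable_norm_sq _)
  rw [integral_add h2 ((integrable_norm_sq _).const_mul c), integral_add (integrable_norm_sq _)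
    (integrable_norm_sq _), integral_const_mul, integral_norm_sq, integral_norm_sq,
    integral_norm_sq, inner_add_right, inner_smul_right, inner_self_eq_norm_sq_to_K]
  congr 1
  have e : ‖dx u‖ ^ 2 + ‖dy u‖ ^ 2 = (inner ℂ u (negLap u)).re := by
    refine ((hasSum_norm_sq (dx u)).add (hasSum_norm_sq (dy u))).unique
      ((Complex.hasSum_re (hasSum_inner _ _)).congr_fun fun m => ?_)
    rw [coef_dx h1, coef_dy h1, coef_negLap hu, mul_left_comm (conj (coef u m)),
      Complex.conj_mul']
    simp only [norm_mul, Complex.norm_I, Complex.norm_intCast, mul_pow, sq_abs, freqSq, one_pow]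
    norm_cast
    push_cast
    ring
  rw [Complex.add_re, ← e]
  congr 1
  simp only [Complex.coe_algebraMap]
  norm_cast

/-! ### Continuous functions in `L²` -/

/-- A continuous complex function as an element of `L²`. -/
abbrev contL2 (f : C(Torus, ℂ)) : L2 := ContinuousMap.toLp 2 volume ℂ f

/-- A continuous real function as a continuous complex function. -/
def ofRealC (φ : C(Torus, ℝ)) : C(Torus, ℂ) :=
  ContinuousMap.comp ⟨Complex.ofReal, Complex.continuous_ofReal⟩ φ

@[simp] lemma ofRealC_apply (φ : C(Torus, ℝ)) (z : Torus) : ofRealC φ z = (φ z : ℂ) := rfl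

lemma toL2_eq (φ : C(Torus, ℝ)) : toL2 φ = contL2 (ofRealC φ) := rfl

lemma coeFn_contL2 (f : C(Torus, ℂ)) : ∀ᵐ z : Torus, contL2 f z = f z :=
  ContinuousMap.coeFn_toLp (p := 2) (𝕜 := ℂ) (volume : Measure Torus) f

lemma contL2_injective : Function.Injective contL2 :=
  ContinuousMap.toLp_injective (p := 2) (𝕜 := ℂ) (volume : Measure Torus)

lemma integrable_of_continuous {E : Type*} [NormedAddCommGroup E] {f : Torus → E}
    (hf : Continuous f) : Integrable f (volume : Measure Torus) :=
  hf.integrable_of_hasCompactSupport (.of_compactSpace f)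

lemma inner_contL2 (f g : C(Torus, ℂ)) :
    inner ℂ (contL2 f) (contL2 g) = ∫ z, g z * conj (f z) :=
  ContinuousMap.inner_toLp _ _ _

lemma norm_contL2_sq (f : C(Torus, ℂ)) : ‖contL2 f‖ ^ 2 = ∫ z, ‖f z‖ ^ 2 := by
  rw [← integral_norm_sq]
  refine integral_congr_ae ?_
  filter_upwards [coeFn_contL2 f] with z hz
  rw [hz]

lemma coef_contL2 (f : C(Torus, ℂ)) (m : ℤ × ℤ) :
    coef (contL2 f) m = (4 * Real.pi ^ 2 : ℂ)⁻¹ * ∫ z, expo (-m) z * f z := by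
  unfold coef
  congr 1
  refine integral_congr_ae ?_
  filter_upwards [coeFn_contL2 f] with z hz
  rw [hz]

lemma mulBy_contL2 (φ : C(Torus, ℝ)) (f : C(Torus, ℂ)) :
    mulBy φ (contL2 f) = contL2 (ofRealC φ * f) := by
  refine Lp.ext ?_
  filter_upwards [coeFn_mulBy φ (contL2 f), coeFn_contL2 f, coeFn_contL2 (ofRealC φ * f)]
    with z h1 h2 h3
  rw [h1, h2, h3]
  rfl

lemma coef_star (f : C(Torus, ℂ)) (m : ℤ × ℤ) :
    coef (contL2 (star f)) m = conj (coef (contL2 f) (-m)) := by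
  rw [coef_contL2, coef_contL2, map_mul, ← integral_conj]
  have h3 : (conj (4 * Real.pi ^ 2 : ℂ)⁻¹) = (4 * Real.pi ^ 2 : ℂ)⁻¹ := by
    rw [show (4 * Real.pi ^ 2 : ℂ)⁻¹ = ((4 * Real.pi ^ 2 : ℝ)⁻¹ : ℝ) by push_cast; rfl,
      Complex.conj_ofReal]
  rw [h3]
  congr 2
  ext z
  rw [map_mul, neg_neg, expo_neg]
  rfl

/-! ### Regularity of `H²` functions -/

lemma summable_inv_one_add_sq : Summable fun k : ℤ => (1 + (k : ℝ) ^ 2)⁻¹ := by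
  have h1 : Summable fun k : ℤ => 1 / (k : ℝ) ^ 2 :=
    Real.summable_one_div_int_pow.2 one_lt_two
  have h2 : Summable fun k : ℤ => if k = 0 then (1 : ℝ) else 0 := (hasSum_ite_eq 0 1).summable
  refine Summable.of_nonneg_of_le (fun k => by positivity) (fun k => ?_) (h1.add h2)
  split_ifs with hk
  · subst hk; simp
  · have : (0 : ℝ) < (k : ℝ) ^ 2 := by positivity
    rw [add_zero, one_div]
    gcongr
    linarith

/-- Since `(1 + k²)(1 + j²) ≤ (1 + k² + j²)²`, the double series is dominated by a product of two
convergent ones. It drives both the continuity of `H²` functions and the compactness of the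
resolvent. -/
lemma summable_inv_freqSq : Summable fun m : ℤ × ℤ => ((1 + freqSq m) ^ 2)⁻¹ := by
  have h := summable_inv_one_add_sq.mul_of_nonneg summable_inv_one_add_sq
    (fun k => by positivity) (fun k => by positivity)
  refine Summable.of_nonneg_of_le (fun m => by positivity) (fun m => ?_) h
  rw [← mul_inv]
  gcongr
  unfold freqSq
  nlinarith [sq_nonneg (m.1 : ℝ), sq_nonneg (m.2 : ℝ), mul_nonneg (sq_nonneg (m.1 : ℝ))
    (sq_nonneg (m.2 : ℝ)), sq_nonneg ((m.1 : ℝ) ^ 2), sq_nonneg ((m.2 : ℝ) ^ 2)]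

/-- Split `|û|` as the weight inverse times the weighted coefficient and use `ab ≤ a² + b²`; both
squares are summable. -/
lemma summable_norm_coef {u : L2} (hu : u ∈ Hper 2) : Summable fun m => ‖coef u m‖ := by
  refine Summable.of_nonneg_of_le (fun m => norm_nonneg _) (fun m => ?_)
    (summable_inv_freqSq.add (mem_Hper.1 hu))
  have h0 := freqSq_nonneg m
  have hp : 0 < 1 + freqSq m := by linarith
  have h1 : ‖coef u m‖ = (1 + freqSq m)⁻¹ * ((1 + freqSq m) * ‖coef u m‖) := by
    field_simp
  have h2 : ((1 + freqSq m) ^ 2)⁻¹ = ((1 + freqSq m)⁻¹) ^ 2 := by rw [inv_pow]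
  have h3 : 0 ≤ (1 + freqSq m)⁻¹ * ((1 + freqSq m) * ‖coef u m‖) := by positivity
  rw [h2, ← mul_pow, h1]
  have h4 : (1 + freqSq m) * ((1 + freqSq m)⁻¹ * ((1 + freqSq m) * ‖coef u m‖)) =
      (1 + freqSq m) * ‖coef u m‖ := by field_simp
  rw [h4]
  nlinarith [sq_nonneg ((1 + freqSq m)⁻¹ - (1 + freqSq m) * ‖coef u m‖)]

/-- Elements of `H²` have a continuous representative. -/
lemma exists_contL2_eq {u : L2} (hu : u ∈ Hper 2) : ∃ f : C(Torus, ℂ), contL2 f = u := by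
  have hs : Summable fun m => coef u m • expo m := by
    refine Summable.of_norm_bounded (summable_norm_coef hu) fun m => ?_
    rw [norm_smul]
    refine mul_le_of_le_one_right (norm_nonneg _) ?_
    exact (ContinuousMap.norm_le _ zero_le_one).2 fun z => (norm_expo_apply m z).le
  refine ⟨∑' m, coef u m • expo m, ext_coef fun n => ?_⟩
  have h1 : contL2 (∑' m, coef u m • expo m) = ∑' m, coef u m • expoL2 m := by
    rw [contL2, ContinuousLinearMap.map_tsum _ hs]
    simp only [map_smul]
    rfl
  rw [h1]
  have h2 := (ContinuousMap.toLp 2 (volume : Measure Torus) ℂ).summable hs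
  refine coef_tsum (h2.congr fun m => ?_) n
  rw [map_smul]
  rfl

/-! ### Translations -/

/-- The translate `z ↦ f (z + a)`. -/
def translate {E : Type*} [TopologicalSpace E] (a : Torus) (f : C(Torus, E)) : C(Torus, E) :=
  f.comp ⟨fun z => z + a, by fun_prop⟩

@[simp] lemma translate_apply {E : Type*} [TopologicalSpace E] (a : Torus) (f : C(Torus, E))
    (z : Torus) : translate a f z = f (z + a) := rfl

instance volume_isAddRightInvariant : (volume : Measure Torus).IsAddRightInvariant :=
  inferInstanceAs (((volume : Measure Circ).prod (volume : Measure Circ)).IsAddRightInvariant)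

lemma integral_translate {E : Type*} [NormedAddCommGroup E] [NormedSpace ℝ E] (a : Torus)
    (f : Torus → E) : ∫ z, f (z + a) = ∫ z, f z :=
  integral_add_right_eq_self (μ := (volume : Measure Torus)) f a

lemma expo_apply_add (m : ℤ × ℤ) (z a : Torus) : expo m (z + a) = expo m z * expo m a := by
  simp only [expo, ContinuousMap.coe_mk, fourier_apply, Prod.fst_add, Prod.snd_add, smul_add,
    AddCircle.toCircle_add, Circle.coe_mul]
  ring

/-- Translation acts on the Fourier side as multiplication by a character, so differences of
translates have explicit symbols. -/
lemma coef_translate (a : Torus) (f : C(Torus, ℂ)) (m : ℤ × ℤ) :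
    coef (contL2 (translate a f)) m = expo m a * coef (contL2 f) m := by
  rw [coef_contL2, coef_contL2, mul_left_comm]
  congr 1
  rw [← integral_translate a (fun z => expo (-m) z * f z), ← integral_const_mul]
  congr 1
  ext z
  rw [expo_apply_add, expo_neg _ a]
  have h : expo m a * conj (expo m a) = 1 := by
    rw [Complex.mul_conj', norm_expo_apply]; simp
  rw [translate_apply]
  linear_combination (- expo (-m) z * f (z + a)) * h

lemma coef_translate_sub (a : Torus) (f : C(Torus, ℂ)) (m : ℤ × ℤ) :
    coef (contL2 (translate a f) - contL2 f) m = (expo m a - 1) * coef (contL2 f) m := by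
  rw [coef_sub, coef_translate]; ring

lemma norm_expo_fst_sub_one (m : ℤ × ℤ) (h : ℝ) :
    ‖expo m ((h : Circ), 0) - 1‖ ^ 2 = (2 * Real.sin (m.1 * h / 2)) ^ 2 := by
  have : expo m ((h : Circ), 0) = Complex.exp (Complex.I * ((m.1 * h : ℝ) : ℂ)) := by
    simp only [expo, ContinuousMap.coe_mk, fourier_eval_zero, mul_one]
    rw [fourier_coe_apply]
    congr 1
    push_cast
    have h2 : (Real.pi : ℂ) ≠ 0 := by exact_mod_cast Real.pi_ne_zero
    field_simp
  rw [this, Complex.norm_exp_I_mul_ofReal_sub_one, Real.norm_eq_abs, sq_abs]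

lemma norm_expo_snd_sub_one (m : ℤ × ℤ) (h : ℝ) :
    ‖expo m (0, (h : Circ)) - 1‖ ^ 2 = (2 * Real.sin (m.2 * h / 2)) ^ 2 := by
  have : expo m (0, (h : Circ)) = Complex.exp (Complex.I * ((m.2 * h : ℝ) : ℂ)) := by
    simp only [expo, ContinuousMap.coe_mk, fourier_eval_zero, one_mul]
    rw [fourier_coe_apply]
    congr 1
    push_cast
    have h2 : (Real.pi : ℂ) ≠ 0 := by exact_mod_cast Real.pi_ne_zero
    field_simp
  rw [this, Complex.norm_exp_I_mul_ofReal_sub_one, Real.norm_eq_abs, sq_abs]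

/-- The symbol of the five-point discretization of `-Δ` with step `h`. -/
def discreteSymbol (h : ℝ) (m : ℤ × ℤ) : ℝ :=
  (2 * Real.sin (m.1 * h / 2) / h) ^ 2 + (2 * Real.sin (m.2 * h / 2) / h) ^ 2

lemma discreteSymbol_nonneg (h : ℝ) (m : ℤ × ℤ) : 0 ≤ discreteSymbol h m := by
  unfold discreteSymbol; positivity

/-- From `|sin t| ≤ |t|`. The bound is uniform in the step, as dominated convergence requires. -/
lemma discreteSymbol_le {h : ℝ} (hh : h ≠ 0) (m : ℤ × ℤ) : discreteSymbol h m ≤ freqSq m := by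
  have key : ∀ k : ℝ, (2 * Real.sin (k * h / 2) / h) ^ 2 ≤ k ^ 2 := by
    intro k
    refine sq_le_sq.2 ?_
    rw [abs_div, div_le_iff₀ (abs_pos.2 hh), abs_mul, abs_two, ← abs_mul]
    have h1 : |Real.sin (k * h / 2)| ≤ |k * h / 2| := Real.abs_sin_le_abs
    rw [abs_div, abs_two] at h1
    linarith
  exact add_le_add (key _) (key _)

lemma tendsto_discreteSymbol (m : ℤ × ℤ) :
    Tendsto (fun h => discreteSymbol h m) (𝓝[≠] 0) (𝓝 (freqSq m)) := by
  have key : ∀ k : ℝ, Tendsto (fun h => (2 * Real.sin (k * h / 2) / h) ^ 2) (𝓝[≠] 0)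
      (𝓝 (k ^ 2)) := by
    intro k
    have hd : HasDerivAt (fun h : ℝ => 2 * Real.sin (k * h / 2)) k 0 := by
      have h1 : HasDerivAt (fun h : ℝ => k * h / 2) (k * 1 / 2) 0 :=
        ((hasDerivAt_id (0 : ℝ)).const_mul k).div_const 2
      have h2 := (h1.sin).const_mul 2
      refine h2.congr_deriv ?_
      rw [mul_zero, zero_div, Real.cos_zero]
      ring
    have h3 := hd.tendsto_slope_zero
    refine Tendsto.pow (h3.congr fun t => ?_) 2
    simp [div_eq_inv_mul]
  exact (key _).add (key _)

/-! ### The discrete Picone identity -/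

/-- The discrete Picone identity: `φ > 0`, `w = |f|² / φ`, `v = f / φ`. -/
lemma picone {φ ψ : ℝ} (hφ : φ ≠ 0) (hψ : ψ ≠ 0) (f g : ℂ) :
    ‖g - f‖ ^ 2 = (ψ - φ) * (‖g‖ ^ 2 / ψ - ‖f‖ ^ 2 / φ) + φ * ψ * ‖g / ψ - f / φ‖ ^ 2 := by
  simp only [Complex.sq_norm, Complex.normSq_apply, Complex.sub_re, Complex.sub_im,
    Complex.div_ofReal_re, Complex.div_ofReal_im]
  field_simp
  ring

lemma hasSum_norm_translate (a : Torus) (f : C(Torus, ℂ)) :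
    HasSum (fun m => (4 * Real.pi ^ 2) * (‖expo m a - 1‖ ^ 2 * ‖coef (contL2 f) m‖ ^ 2))
      (∫ z, ‖f (z + a) - f z‖ ^ 2) := by
  have h1 : ∫ z, ‖f (z + a) - f z‖ ^ 2 = ‖contL2 (translate a f) - contL2 f‖ ^ 2 := by
    rw [contL2, contL2, ← map_sub, norm_contL2_sq]
    rfl
  rw [h1]
  refine (hasSum_norm_sq _).congr_fun fun m => ?_
  rw [coef_translate_sub, norm_mul, mul_pow]

/-- The polarized form of `hasSum_norm_translate`. It asks only continuity of `w`, which will be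
`|f|² / φ`. -/
lemma hasSum_mul_translate (a : Torus) (φ w : C(Torus, ℝ)) :
    HasSum (fun m => (4 * Real.pi ^ 2) * (‖expo m a - 1‖ ^ 2 *
        (conj (coef (toL2 φ) m) * coef (toL2 w) m).re))
      (∫ z, (φ (z + a) - φ z) * (w (z + a) - w z)) := by
  have h1 : ∫ z, (φ (z + a) - φ z) * (w (z + a) - w z) =
      (inner ℂ (contL2 (translate a (ofRealC φ)) - contL2 (ofRealC φ))
        (contL2 (translate a (ofRealC w)) - contL2 (ofRealC w))).re := by
    rw [contL2, contL2, ← map_sub, contL2, contL2, ← map_sub, inner_contL2]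
    rw [← Complex.ofReal_re (∫ z, (φ (z + a) - φ z) * (w (z + a) - w z)),
      ← integral_complex_ofReal]
    congr 2
    ext z
    simp only [ContinuousMap.sub_apply, translate_apply, ofRealC_apply, map_sub,
      Complex.conj_ofReal]
    push_cast
    ring
  rw [h1]
  refine (Complex.hasSum_re (hasSum_inner _ _)).congr_fun fun m => ?_
  rw [coef_translate_sub, coef_translate_sub, map_mul, toL2_eq, toL2_eq]
  have h2 : conj (expo m a - 1) * (expo m a - 1) = ((‖expo m a - 1‖ ^ 2 : ℝ) : ℂ) := by
    rw [Complex.conj_mul']; push_cast; rfl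
  have h3 : (4 * Real.pi ^ 2 : ℂ) * (conj (expo m a - 1) * conj (coef (contL2 (ofRealC φ)) m) *
      ((expo m a - 1) * coef (contL2 (ofRealC w)) m)) =
      ((4 * Real.pi ^ 2 * ‖expo m a - 1‖ ^ 2 : ℝ) : ℂ) *
        (conj (coef (contL2 (ofRealC φ)) m) * coef (contL2 (ofRealC w)) m) := by
    rw [Complex.ofReal_mul, ← h2]
    push_cast
    ring
  rw [h3, Complex.re_ofReal_mul]
  ring

/-! ### The ground state representation -/

/-- The pointwise identity `picone` at `z` and `z + a`, integrated, with the weight `φ(z) φ(z + a)`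
bounded below by `δ²`. -/
lemma integral_picone {φ w : C(Torus, ℝ)} {f v : C(Torus, ℂ)} {δ : ℝ} (hδ : 0 < δ)
    (hφ : ∀ z, δ ≤ φ z) (hw : ∀ z, w z = ‖f z‖ ^ 2 / φ z) (hv : ∀ z, v z = f z / φ z)
    (a : Torus) :
    (∫ z, (φ (z + a) - φ z) * (w (z + a) - w z)) + δ ^ 2 * ∫ z, ‖v (z + a) - v z‖ ^ 2 ≤
      ∫ z, ‖f (z + a) - f z‖ ^ 2 := by
  rw [← integral_const_mul, ← integral_add (integrable_of_continuous (by fun_prop))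
    (integrable_of_continuous (by fun_prop))]
  refine integral_mono (integrable_of_continuous (by fun_prop))
    (integrable_of_continuous (by fun_prop)) fun z => ?_
  have h1 := hφ z
  have h2 := hφ (z + a)
  have h := picone (hδ.trans_le h1).ne' (hδ.trans_le h2).ne' (f z) (f (z + a))
  simp only [hw, hv]
  rw [h]
  gcongr
  rw [sq]
  gcongr
  exact hδ.le.trans h1

lemma hasSum_discrete_norm (f : C(Torus, ℂ)) (h : ℝ) :
    HasSum (fun m => (4 * Real.pi ^ 2) * (discreteSymbol h m * ‖coef (contL2 f) m‖ ^ 2))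
      (((∫ z, ‖f (z + ((h : Circ), 0)) - f z‖ ^ 2) +
        ∫ z, ‖f (z + (0, (h : Circ))) - f z‖ ^ 2) / h ^ 2) := by
  refine (((hasSum_norm_translate _ f).add (hasSum_norm_translate _ f)).div_const
    (h ^ 2)).congr_fun fun m => ?_
  rw [norm_expo_fst_sub_one, norm_expo_snd_sub_one, discreteSymbol, div_pow, div_pow]
  ring

lemma hasSum_discrete_mul (φ w : C(Torus, ℝ)) (h : ℝ) :
    HasSum (fun m => (4 * Real.pi ^ 2) * (discreteSymbol h m *
        (conj (coef (toL2 φ) m) * coef (toL2 w) m).re))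
      (((∫ z, (φ (z + ((h : Circ), 0)) - φ z) * (w (z + ((h : Circ), 0)) - w z)) +
        ∫ z, (φ (z + (0, (h : Circ))) - φ z) * (w (z + (0, (h : Circ))) - w z)) / h ^ 2) := by
  refine (((hasSum_mul_translate _ φ w).add (hasSum_mul_translate _ φ w)).div_const
    (h ^ 2)).congr_fun fun m => ?_
  rw [norm_expo_fst_sub_one, norm_expo_snd_sub_one, discreteSymbol, div_pow, div_pow]
  ring

/-- Only `u` needs two derivatives: all of the symbol is charged to `u`, and `|freqSq û| |v̂|` is
dominated by a sum of squares independent of the step. Hence `v` may be any `L²` function. -/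
lemma tendsto_discrete {u v : L2} (hu : u ∈ Hper 2) :
    Tendsto (fun h => ∑' m, (4 * Real.pi ^ 2) * (discreteSymbol h m *
        (conj (coef u m) * coef v m).re)) (𝓝[≠] 0)
      (𝓝 (inner ℂ (negLap u) v).re) := by
  have hs := Complex.hasSum_re (hasSum_inner (negLap u) v)
  have he : ∀ m, ((4 * Real.pi ^ 2 : ℂ) * (conj (coef (negLap u) m) * coef v m)).re =
      (4 * Real.pi ^ 2) * (freqSq m * (conj (coef u m) * coef v m).re) := by
    intro m
    rw [coef_negLap hu, map_mul, Complex.conj_ofReal, mul_assoc (freqSq m : ℂ),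
      show (4 * Real.pi ^ 2 : ℂ) = ((4 * Real.pi ^ 2 : ℝ) : ℂ) by push_cast; rfl,
      Complex.re_ofReal_mul, Complex.re_ofReal_mul]
  simp only [he] at hs
  rw [← hs.tsum_eq]
  have hb : Summable fun m => (4 * Real.pi ^ 2) *
      (‖coef (negLap u) m‖ ^ 2 + ‖coef v m‖ ^ 2) :=
    ((summable_coef_sq _).add (summable_coef_sq v)).mul_left _
  refine tendsto_tsum_of_dominated_convergence hb (fun m => ?_) ?_
  · exact ((tendsto_discreteSymbol m).mul_const _).const_mul _
  · filter_upwards [self_mem_nhdsWithin] with h hh m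
    have h0 := discreteSymbol_nonneg h m
    rw [norm_mul, norm_mul (discreteSymbol h m), Real.norm_of_nonneg h0,
      Real.norm_of_nonneg (by positivity)]
    gcongr
    have h1 : ‖(conj (coef u m) * coef v m).re‖ ≤ ‖coef u m‖ * ‖coef v m‖ := by
      refine (Complex.abs_re_le_norm _).trans ?_
      rw [norm_mul, Complex.norm_conj]
    calc discreteSymbol h m * ‖(conj (coef u m) * coef v m).re‖
        ≤ freqSq m * (‖coef u m‖ * ‖coef v m‖) :=
          mul_le_mul (discreteSymbol_le hh m) h1 (norm_nonneg _) (freqSq_nonneg m)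
      _ = ‖coef (negLap u) m‖ * ‖coef v m‖ := by
          rw [coef_negLap hu, norm_mul, Complex.norm_real, Real.norm_of_nonneg (freqSq_nonneg m),
            mul_assoc]
      _ ≤ _ := by nlinarith [sq_nonneg (‖coef (negLap u) m‖ - ‖coef v m‖),
            sq_nonneg (‖coef (negLap u) m‖ + ‖coef v m‖)]

/-- A quantitative form of `∫ |∇f|² - ∇φ · ∇(|f|²/φ) = ∫ φ² |∇(f/φ)|²`. -/
lemma ground_state_le {φ w : C(Torus, ℝ)} {f v : C(Torus, ℂ)} {δ : ℝ} (hδ : 0 < δ)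
    (hφ : ∀ z, δ ≤ φ z) (hw : ∀ z, w z = ‖f z‖ ^ 2 / φ z) (hv : ∀ z, v z = f z / φ z)
    (hφ2 : toL2 φ ∈ Hper 2) (hf : contL2 f ∈ Hper 2) (n : ℤ × ℤ) :
    δ ^ 2 * ((4 * Real.pi ^ 2) * (freqSq n * ‖coef (contL2 v) n‖ ^ 2)) ≤
      (inner ℂ (negLap (contL2 f)) (contL2 f)).re -
        (inner ℂ (negLap (toL2 φ)) (toL2 w)).re := by
  have t1 := tendsto_discrete (v := contL2 f) hf
  have t2 := tendsto_discrete (v := toL2 w) hφ2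
  have t3 : Tendsto (fun h => δ ^ 2 * ((4 * Real.pi ^ 2) *
      (discreteSymbol h n * ‖coef (contL2 v) n‖ ^ 2))) (𝓝[≠] 0) _ :=
    (((tendsto_discreteSymbol n).mul_const (‖coef (contL2 v) n‖ ^ 2)).const_mul
      (4 * Real.pi ^ 2)).const_mul (δ ^ 2)
  -- The inequality is proved at every step `h`; at `h = 0` both sides vanish because division by
  -- zero gives zero.
  refine le_of_tendsto_of_tendsto t3 (t1.sub t2) (Eventually.of_forall fun h => ?_)
  have e : ∀ m, (conj (coef (contL2 f) m) * coef (contL2 f) m).re = ‖coef (contL2 f) m‖ ^ 2 := by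
    intro m
    rw [Complex.conj_mul']
    norm_cast
  simp only [e]
  rw [(hasSum_discrete_norm f h).tsum_eq, (hasSum_discrete_mul φ w h).tsum_eq]
  have s3 := hasSum_discrete_norm v h
  -- All modes of the discrete energy of `v` are nonnegative, so keeping only mode `n` gives a lower
  -- bound.
  have h3 := le_hasSum s3 n fun m _ => by
    have := discreteSymbol_nonneg h m
    positivity
  refine (mul_le_mul_of_nonneg_left h3 (sq_nonneg δ)).trans ?_
  rw [← sub_div, ← mul_div_assoc]
  gcongr
  have p1 := integral_picone hδ hφ hw hv ((h : Circ), 0)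
  have p2 := integral_picone hδ hφ hw hv (0, (h : Circ))
  linarith

lemma exists_pos_le {φ : C(Torus, ℝ)} (hφ : ∀ z, 0 < φ z) : ∃ δ > 0, ∀ z, δ ≤ φ z := by
  obtain ⟨z, -, hz⟩ := isCompact_univ.exists_isMinOn (Set.univ_nonempty (α := Torus))
    φ.continuous.continuousOn
  exact ⟨φ z, hφ z, fun y => hz (Set.mem_univ y)⟩

lemma toL2_pow (φ : C(Torus, ℝ)) : toL2 (φ ^ 2) = contL2 (ofRealC φ * ofRealC φ) := by
  rw [toL2_eq]
  congr 1
  ext z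
  simp [sq]

/-- The quadratic form of `-Δ + c - φ` is nonnegative, with a lower bound that detects
whether `f / φ` is constant. -/
lemma IsPeriodicMinimizer.quadratic_le {c : ℝ} {φ : C(Torus, ℝ)} (h : IsPeriodicMinimizer c φ)
    {δ : ℝ} (hδ : 0 < δ) (hφ : ∀ z, δ ≤ φ z) {f v : C(Torus, ℂ)} (hv : ∀ z, v z = f z / φ z)
    (hf : contL2 f ∈ Hper 2) (n : ℤ × ℤ) :
    δ ^ 2 * ((4 * Real.pi ^ 2) * (freqSq n * ‖coef (contL2 v) n‖ ^ 2)) ≤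
      (inner ℂ (contL2 f) (negLap (contL2 f) + ((c : ℂ) • contL2 f - mulBy φ (contL2 f)))).re := by
  have hpos := h.pos
  let w : C(Torus, ℝ) := ⟨fun z => ‖f z‖ ^ 2 / φ z,
    (by fun_prop : Continuous fun z => ‖f z‖ ^ 2).div φ.continuous fun z => (hpos z).ne'⟩
  refine (ground_state_le (w := w) hδ hφ (fun z => rfl) hv h.mem_Hs.1 hf n).trans (le_of_eq ?_)
  -- By the equation, `-Δφ` times `|f|² / φ` is `(φ² - cφ) |f|² / φ = (φ - c) |f|²`, so subtracting
  -- its integral supplies exactly the zeroth-order terms of the form.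
  have e1 : negLap (toL2 φ) = contL2 (ofRealC φ * ofRealC φ - (c : ℂ) • ofRealC φ) := by
    have := h.equation
    rw [sub_eq_zero] at this
    rw [eq_sub_of_add_eq this, toL2_pow, toL2_eq, contL2, contL2, contL2, map_sub, map_smul]
  have e2 : ((c : ℂ) • contL2 f - mulBy φ (contL2 f)) =
      contL2 ((c : ℂ) • f - ofRealC φ * f) := by
    rw [mulBy_contL2, contL2, contL2, contL2, map_sub, map_smul]
  rw [inner_add_right, negLap_symm hf hf, e1, e2, toL2_eq, Complex.add_re, sub_eq_add_neg,
    inner_contL2, inner_contL2, ← Complex.neg_re, ← integral_neg]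
  congr 3
  ext z
  have h1 : (φ z : ℂ) ≠ 0 := by exact_mod_cast (hpos z).ne'
  have h2 : (f z) * conj (f z) = ((‖f z‖ ^ 2 : ℝ) : ℂ) := by
    rw [Complex.mul_conj']; push_cast; rfl
  have h3 : ((w z : ℝ) : ℂ) = f z * conj (f z) / φ z := by
    rw [h2, ← Complex.ofReal_div]; rfl
  simp only [ContinuousMap.sub_apply, ContinuousMap.mul_apply, ContinuousMap.smul_apply,
    ofRealC_apply, map_sub, map_mul, Complex.conj_ofReal, smul_eq_mul, h3]
  field_simp
  ring

/-- Functions with vanishing `-Δ + c - φ` form are multiples of `φ`. -/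
lemma IsPeriodicMinimizer.eq_smul {c : ℝ} {φ : C(Torus, ℝ)} (h : IsPeriodicMinimizer c φ)
    {u : L2} (hu : u ∈ Hper 2)
    (h0 : (inner ℂ u (negLap u + ((c : ℂ) • u - mulBy φ u))).re ≤ 0) :
    ∃ a : ℂ, u = a • toL2 φ := by
  obtain ⟨f, rfl⟩ := exists_contL2_eq hu
  obtain ⟨δ, hδ, hφ⟩ := exists_pos_le h.pos
  have hne : ∀ z, (φ z : ℂ) ≠ 0 := fun z => by exact_mod_cast (h.pos z).ne'
  let v : C(Torus, ℂ) := ⟨fun z => f z / φ z,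
    f.continuous.div (Complex.continuous_ofReal.comp φ.continuous) hne⟩
  have hc : ∀ n, n ≠ 0 → coef (contL2 v) n = 0 := by
    intro n hn
    have h1 := (h.quadratic_le hδ hφ (v := v) (fun z => rfl) hu n).trans h0
    have hn0 : 0 < freqSq n := by
      refine lt_of_le_of_ne (freqSq_nonneg n) fun h => hn ?_
      unfold freqSq at h
      have h1 : (n.1 : ℝ) ^ 2 = 0 := by nlinarith [sq_nonneg (n.1 : ℝ), sq_nonneg (n.2 : ℝ)]
      have h2 : (n.2 : ℝ) ^ 2 = 0 := by nlinarith [sq_nonneg (n.1 : ℝ), sq_nonneg (n.2 : ℝ)]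
      ext
      · simpa using h1
      · simpa using h2
    by_contra hne
    have : 0 < ‖coef (contL2 v) n‖ := norm_pos_iff.2 hne
    have : 0 < δ ^ 2 * ((4 * Real.pi ^ 2) * (freqSq n * ‖coef (contL2 v) n‖ ^ 2)) := by
      have := Real.pi_pos
      positivity
    linarith
  -- Only the zero mode of `v` survives, so `v` is constant in `L²`; by continuity it is then
  -- constant everywhere.
  have hv : contL2 v = contL2 (coef (contL2 v) 0 • 1) := by
    rw [← expo_zero]
    refine ext_coef fun n => ?_
    rw [contL2, contL2, map_smul, coef_smul]
    change _ = _ * coef (expoL2 0) n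
    rw [coef_expoL2]
    split_ifs with hn
    · rw [mul_one, ← hn]
    · rw [mul_zero]; exact hc n (Ne.symm hn)
  refine ⟨coef (contL2 v) 0, ?_⟩
  rw [toL2_eq, contL2, contL2, ← map_smul]
  congr 1
  ext z
  have h2 : v z = coef (contL2 v) 0 := by
    conv_lhs => rw [contL2_injective hv]
    simp
  have h3 : f z = v z * φ z := (div_mul_cancel₀ _ (hne z)).symm
  rw [h3, h2]
  rfl

/-! ### The second variation at a minimizer -/

lemma integral_pos_of_continuous {f : Torus → ℝ} (hf : Continuous f) (hpos : ∀ z, 0 < f z) :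
    0 < ∫ z, f z := by
  rw [integral_pos_iff_support_of_nonneg (fun z => (hpos z).le) (integrable_of_continuous hf)]
  have : Function.support f = Set.univ := Set.eq_univ_of_forall fun z => (hpos z).ne'
  rw [this]
  exact isOpen_univ.measure_pos _ Set.univ_nonempty

lemma inner_toL2 (φ ψ : C(Torus, ℝ)) : inner ℂ (toL2 φ) (toL2 ψ) = ((∫ z, φ z * ψ z : ℝ) : ℂ) := by
  rw [toL2_eq, toL2_eq, inner_contL2, ← integral_complex_ofReal]
  congr 1
  ext z
  simp [mul_comm]

lemma toL2_add (φ ψ : C(Torus, ℝ)) : toL2 (φ + ψ) = toL2 φ + toL2 ψ := by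
  rw [toL2_eq, toL2_eq, toL2_eq, contL2, contL2, contL2, ← map_add]
  congr 1
  ext z
  simp

lemma toL2_smul (t : ℝ) (φ : C(Torus, ℝ)) : toL2 (t • φ) = (t : ℂ) • toL2 φ := by
  rw [toL2_eq, toL2_eq, contL2, contL2, ← map_smul]
  congr 1
  ext z
  simp

lemma IsPeriodicMinimizer.negLap_add_smul {c : ℝ} {φ : C(Torus, ℝ)}
    (h : IsPeriodicMinimizer c φ) : negLap (toL2 φ) + (c : ℂ) • toL2 φ = toL2 (φ ^ 2) :=
  sub_eq_zero.1 h.equation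

lemma integral_norm_toL2_pow (φ : C(Torus, ℝ)) (hφ : ∀ z, 0 ≤ φ z) :
    ∫ z, ‖toL2 φ z‖ ^ 3 = ∫ z, φ z ^ 3 := by
  refine integral_congr_ae ?_
  filter_upwards [coeFn_toL2 φ] with z hz
  rw [hz, Complex.norm_real, Real.norm_of_nonneg (hφ z)]

lemma inner_form_smul (c s : ℝ) {u : L2} (hu : u ∈ Hper 2) :
    (inner ℂ ((s : ℂ) • u) (negLap ((s : ℂ) • u) + (c : ℂ) • (s : ℂ) • u)).re =
      s ^ 2 * (inner ℂ u (negLap u + (c : ℂ) • u)).re := by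
  rw [negLap_smul _ hu, smul_comm (c : ℂ), ← smul_add, inner_smul_left, inner_smul_right,
    Complex.conj_ofReal, ← mul_assoc, ← Complex.ofReal_mul, Complex.re_ofReal_mul, sq]

lemma inner_form_add (c : ℝ) {u v : L2} (hu : u ∈ Hper 2) (hv : v ∈ Hper 2) :
    (inner ℂ (u + v) (negLap (u + v) + (c : ℂ) • (u + v))).re =
      (inner ℂ u (negLap u + (c : ℂ) • u)).re + 2 * (inner ℂ v (negLap u + (c : ℂ) • u)).re +
        (inner ℂ v (negLap v + (c : ℂ) • v)).re := by
  have h1 : inner ℂ u (negLap v + (c : ℂ) • v) = conj (inner ℂ v (negLap u + (c : ℂ) • u)) := by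
    rw [inner_conj_symm, inner_add_left, inner_add_right, negLap_symm hu hv, inner_smul_left,
      inner_smul_right, Complex.conj_ofReal]
  have h2 : negLap (u + v) + (c : ℂ) • (u + v) =
      (negLap u + (c : ℂ) • u) + (negLap v + (c : ℂ) • v) := by
    rw [negLap_add hu hv, smul_add]; abel
  rw [h2, inner_add_left, inner_add_right u, inner_add_right v, h1]
  simp only [Complex.add_re, Complex.conj_re]
  ring

/-- The terms `lam³` cancel; dividing by `t²` and letting `t → 0` leaves `6 lam² a ≤ 3 lam² e`. -/
lemma le_of_forall_small {lam a b e : ℝ} (hlam : 0 < lam)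
    (h : ∀ᶠ t : ℝ in 𝓝[≠] 0,
      lam * (lam + 3 * t ^ 2 * a + t ^ 3 * b) ^ 2 ≤ (lam + t ^ 2 * e) ^ 3) : 2 * a ≤ e := by
  have h1 : ∀ᶠ t : ℝ in 𝓝[≠] 0, lam * (2 * lam * (3 * a + t * b) + t ^ 2 * (3 * a + t * b) ^ 2) ≤
      3 * lam ^ 2 * e + 3 * lam * t ^ 2 * e ^ 2 + t ^ 4 * e ^ 3 := by
    filter_upwards [h, self_mem_nhdsWithin] with t ht h0
    have h2 : 0 < t ^ 2 := by
      have : t ≠ 0 := h0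
      positivity
    refine le_of_mul_le_mul_left ?_ h2
    nlinarith
  have c1 : Tendsto (fun t : ℝ => lam * (2 * lam * (3 * a + t * b) + t ^ 2 * (3 * a + t * b) ^ 2))
      (𝓝[≠] 0) (𝓝 (lam * (2 * lam * (3 * a + 0 * b) + 0 ^ 2 * (3 * a + 0 * b) ^ 2))) :=
    (Continuous.tendsto (by fun_prop) 0).mono_left nhdsWithin_le_nhds
  have c2 : Tendsto (fun t : ℝ => 3 * lam ^ 2 * e + 3 * lam * t ^ 2 * e ^ 2 + t ^ 4 * e ^ 3)
      (𝓝[≠] 0) (𝓝 (3 * lam ^ 2 * e + 3 * lam * 0 ^ 2 * e ^ 2 + 0 ^ 4 * e ^ 3)) :=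
    (Continuous.tendsto (by fun_prop) 0).mono_left nhdsWithin_le_nhds
  have h2 := le_of_tendsto_of_tendsto c1 c2 h1
  have h3 : 0 < 3 * lam ^ 2 := by positivity
  refine le_of_mul_le_mul_left ?_ h3
  nlinarith

/-- Second variation in real directions tangent to the constraint. -/
lemma IsPeriodicMinimizer.second_variation_real {c : ℝ} {φ : C(Torus, ℝ)}
    (h : IsPeriodicMinimizer c φ) {v : C(Torus, ℝ)} (hv : toL2 v ∈ Hs 2)
    (h0 : ∫ z, φ z ^ 2 * v z = 0) :
    2 * ∫ z, φ z * v z ^ 2 ≤ (inner ℂ (toL2 v) (negLap (toL2 v) + (c : ℂ) • toL2 v)).re := by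
  obtain ⟨lam, ⟨-, hlam⟩, hmin⟩ := h.minimizes
  rw [integral_norm_toL2_pow φ fun z => (h.pos z).le] at hlam
  have hpos : 0 < lam := by
    rw [← hlam]
    exact integral_pos_of_continuous (by fun_prop) fun z => pow_pos (h.pos z) 3
  obtain ⟨δ, hδ, hφ⟩ := exists_pos_le h.pos
  set a := ∫ z, φ z * v z ^ 2 with ha
  set b := ∫ z, v z ^ 3 with hb
  set e := (inner ℂ (toL2 v) (negLap (toL2 v) + (c : ℂ) • toL2 v)).re with he
  refine le_of_forall_small (b := b) hpos ?_
  -- For such `t` the perturbation `φ + t v` stays positive, so its cubed modulus integrates to a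
  -- polynomial in `t`.
  have hsmall : ∀ᶠ t : ℝ in 𝓝 0, |t| * ‖v‖ < δ := by
    have : Continuous fun t : ℝ => |t| * ‖v‖ := by fun_prop
    exact (this.tendsto 0).eventually_lt_const (by simpa using hδ)
  refine Eventually.filter_mono nhdsWithin_le_nhds ?_
  filter_upwards [hsmall] with t ht
  set g : C(Torus, ℝ) := φ + t • v with hg
  have hgpos : ∀ z, 0 < g z := by
    intro z
    have h1 : |t * v z| ≤ |t| * ‖v‖ := by
      rw [abs_mul]
      exact mul_le_mul_of_nonneg_left (v.norm_coe_le_norm z) (abs_nonneg t)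
    have h2 := neg_abs_le (t * v z)
    have h3 := hφ z
    change 0 < φ z + t * v z
    linarith
  set J := ∫ z, g z ^ 3 with hJ
  have hJpos : 0 < J := integral_pos_of_continuous (by fun_prop) fun z => pow_pos (hgpos z) 3
  have hJeq : J = lam + 3 * t ^ 2 * a + t ^ 3 * b := by
    have i1 : Integrable (fun z => φ z ^ 3) (volume : Measure Torus) :=
      integrable_of_continuous (by fun_prop)
    have i2 : Integrable (fun z => 3 * t * (φ z ^ 2 * v z)) (volume : Measure Torus) :=
      integrable_of_continuous (by fun_prop)
    have i3 : Integrable (fun z => 3 * t ^ 2 * (φ z * v z ^ 2)) (volume : Measure Torus) :=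
      integrable_of_continuous (by fun_prop)
    have i4 : Integrable (fun z => t ^ 3 * v z ^ 3) (volume : Measure Torus) :=
      integrable_of_continuous (by fun_prop)
    have e1 : J = ∫ z, (φ z ^ 3 + 3 * t * (φ z ^ 2 * v z) + (3 * t ^ 2 * (φ z * v z ^ 2) +
        t ^ 3 * v z ^ 3)) := by
      refine integral_congr_ae (Eventually.of_forall fun z => ?_)
      change (φ z + t * v z) ^ 3 = _
      ring
    have i12 : Integrable (fun z => φ z ^ 3 + 3 * t * (φ z ^ 2 * v z)) (volume : Measure Torus) :=
      i1.add i2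
    have i34 : Integrable (fun z => 3 * t ^ 2 * (φ z * v z ^ 2) + t ^ 3 * v z ^ 3)
      (volume : Measure Torus) := i3.add i4
    rw [e1, integral_add i12 i34, integral_add i1 i2, integral_add i3 i4,
      integral_const_mul, integral_const_mul, integral_const_mul, h0, hlam]
    ring
  -- The factor that puts `s g` back on the constraint: `s³ J = lam`.
  set s := (lam / J) ^ ((3 : ℝ)⁻¹) with hs
  have hspos : 0 < s := Real.rpow_pos_of_pos (div_pos hpos hJpos) _
  have hs3 : s ^ 3 * J = lam := by
    rw [hs, ← Real.rpow_natCast, ← Real.rpow_mul (div_pos hpos hJpos).le]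
    norm_num
    field_simp
  have hgs : toL2 g = toL2 φ + (t : ℂ) • toL2 v := by rw [hg, toL2_add, toL2_smul]
  have hg2 : toL2 g ∈ Hs 2 := by
    rw [hgs]
    exact add_mem h.mem_Hs (Submodule.smul_mem _ _ hv)
  have hsg2 : toL2 (s • g) ∈ Hs 2 := by
    rw [toL2_smul]; exact Submodule.smul_mem _ _ hg2
  have hmem : toL2 (s • g) ∈ constraintSet lam := by
    refine ⟨⟨Hper_two_le_one hsg2.1, hsg2.2⟩, ?_⟩
    rw [integral_norm_toL2_pow _ fun z => mul_nonneg hspos.le (hgpos z).le, ← hs3, hJ,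
      ← integral_const_mul]
    refine integral_congr_ae (Eventually.of_forall fun z => ?_)
    change (s * g z) ^ 3 = _
    ring
  have key : energyB c (toL2 φ) ≤ energyB c (toL2 (s • g)) := hmin hmem
  rw [energyB_eq c h.mem_Hs.1, energyB_eq c hsg2.1, toL2_smul, inner_form_smul c s hg2.1, hgs,
    inner_form_add c h.mem_Hs.1 (Submodule.smul_mem _ _ hv.1), inner_form_smul c t hv.1,
    h.negLap_add_smul, inner_smul_left, inner_toL2, inner_toL2, ← he] at key
  have k1 : ∫ z, φ z * (φ ^ 2) z = lam := by
    rw [← hlam]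
    refine integral_congr_ae (Eventually.of_forall fun z => ?_)
    change φ z * φ z ^ 2 = _
    ring
  have k2 : ∫ z, v z * (φ ^ 2) z = 0 := by
    rw [← h0]
    refine integral_congr_ae (Eventually.of_forall fun z => ?_)
    change v z * φ z ^ 2 = _
    ring
  rw [k1, k2, Complex.ofReal_re, Complex.ofReal_zero, mul_zero, Complex.zero_re] at key
  have key2 : lam ≤ s ^ 2 * (lam + t ^ 2 * e) := by linarith
  -- Cubing makes the scaling enter as `s⁶`; multiplied by `J²` it becomes `(s³ J)² = lam²`, and no
  -- fractional power remains.
  have key3 : lam ^ 3 ≤ (s ^ 2 * (lam + t ^ 2 * e)) ^ 3 := pow_le_pow_left₀ hpos.le key2 3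
  rw [← hJeq]
  have h6 : 0 < lam ^ 2 := by positivity
  refine le_of_mul_le_mul_left ?_ h6
  calc lam ^ 2 * (lam * J ^ 2) = J ^ 2 * lam ^ 3 := by ring
    _ ≤ J ^ 2 * (s ^ 2 * (lam + t ^ 2 * e)) ^ 3 := by gcongr
    _ = (s ^ 3 * J) ^ 2 * (lam + t ^ 2 * e) ^ 3 := by ring
    _ = _ := by rw [hs3]

/-! ### Real and imaginary parts -/

/-- Conjugation commutes with the reflections and sends frequency `m` to `-m`, where `freqSq` takes
the same value. -/
lemma star_mem_Hs {f : C(Torus, ℂ)} (hf : contL2 f ∈ Hs 2) : contL2 (star f) ∈ Hs 2 := by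
  have hinv : ∀ {σ : Torus → Torus} (hσ : MeasurePreserving σ (volume : Measure Torus) volume),
      contL2 f ∈ invariantUnder σ hσ → contL2 (star f) ∈ invariantUnder σ hσ := by
    intro σ hσ h
    change ∀ᵐ z : Torus, _ at h
    change ∀ᵐ z : Torus, _
    have h1 := coeFn_contL2 f
    have h2 := coeFn_contL2 (star f)
    filter_upwards [h, h1, h2, hσ.quasiMeasurePreserving.ae h1, hσ.quasiMeasurePreserving.ae h2]
      with z a1 a2 a3 a4 a5
    rw [a2, a4] at a1
    rw [a3, a5, ContinuousMap.star_apply, ContinuousMap.star_apply, a1]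
  refine ⟨?_, hinv _ hf.2.1, hinv _ hf.2.2⟩
  refine mem_Hper.2 (((Equiv.neg (ℤ × ℤ)).summable_iff.2 (mem_Hper.1 hf.1)).congr fun m => ?_)
  rw [coef_star, Complex.norm_conj]
  simp [freqSq]

/-- The real part of a continuous function. -/
def reC (f : C(Torus, ℂ)) : C(Torus, ℝ) := ⟨fun z => (f z).re, by fun_prop⟩

/-- The imaginary part of a continuous function. -/
def imC (f : C(Torus, ℂ)) : C(Torus, ℝ) := ⟨fun z => (f z).im, by fun_prop⟩

lemma contL2_eq_re_add_im (f : C(Torus, ℂ)) :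
    contL2 f = toL2 (reC f) + Complex.I • toL2 (imC f) := by
  rw [toL2_eq, toL2_eq, contL2, contL2, contL2, ← map_smul, ← map_add]
  congr 1
  ext z
  simp [reC, imC, mul_comm Complex.I, Complex.re_add_im]

lemma contL2_star_eq (f : C(Torus, ℂ)) :
    contL2 (star f) = toL2 (reC f) - Complex.I • toL2 (imC f) := by
  rw [toL2_eq, toL2_eq, contL2, contL2, contL2, ← map_smul, ← map_sub]
  congr 1
  ext z
  apply Complex.ext <;> simp [reC, imC]

lemma reC_mem_Hs {f : C(Torus, ℂ)} (hf : contL2 f ∈ Hs 2) : toL2 (reC f) ∈ Hs 2 := by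
  have h : toL2 (reC f) = (2 : ℂ)⁻¹ • (contL2 f + contL2 (star f)) := by
    rw [contL2_star_eq, contL2_eq_re_add_im]
    module
  rw [h]
  exact Submodule.smul_mem _ _ (add_mem hf (star_mem_Hs hf))

lemma imC_mem_Hs {f : C(Torus, ℂ)} (hf : contL2 f ∈ Hs 2) : toL2 (imC f) ∈ Hs 2 := by
  have h : toL2 (imC f) = ((2 : ℂ)⁻¹ * -Complex.I) • (contL2 f - contL2 (star f)) := by
    rw [contL2_star_eq, contL2_eq_re_add_im, add_sub_sub_cancel, ← two_smul ℂ, smul_smul,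
      smul_smul]
    have : ((2 : ℂ)⁻¹ * -Complex.I * 2 * Complex.I) = 1 := by
      linear_combination -Complex.I_mul_I
    rw [this, one_smul]
  rw [h]
  exact Submodule.smul_mem _ _ (sub_mem hf (star_mem_Hs hf))

lemma hasSum_form (c : ℝ) {u : L2} (hu : u ∈ Hper 2) :
    HasSum (fun m => (4 * Real.pi ^ 2) * ((freqSq m + c) * ‖coef u m‖ ^ 2))
      (inner ℂ u (negLap u + (c : ℂ) • u)).re := by
  refine (Complex.hasSum_re (hasSum_inner _ _)).congr_fun fun m => ?_
  rw [coef_add, coef_smul, coef_negLap hu, ← add_mul, mul_left_comm (conj _), Complex.conj_mul']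
  norm_cast

lemma form_star (c : ℝ) {f : C(Torus, ℂ)} (hf : contL2 f ∈ Hs 2) :
    (inner ℂ (contL2 (star f)) (negLap (contL2 (star f)) + (c : ℂ) • contL2 (star f))).re =
      (inner ℂ (contL2 f) (negLap (contL2 f) + (c : ℂ) • contL2 f)).re := by
  refine (hasSum_form c (star_mem_Hs hf).1).unique
    (((Equiv.neg (ℤ × ℤ)).hasSum_iff.2 (hasSum_form c hf.1)).congr_fun fun m => ?_)
  simp [coef_star, freqSq]

/-- `f` and its conjugate have equal forms, and their coefficients are `R ± iI`. The parallelogram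
law in each mode gives twice the sum of the two parts. -/
lemma form_eq_re_add_im (c : ℝ) {f : C(Torus, ℂ)} (hf : contL2 f ∈ Hs 2) :
    (inner ℂ (contL2 f) (negLap (contL2 f) + (c : ℂ) • contL2 f)).re =
      (inner ℂ (toL2 (reC f)) (negLap (toL2 (reC f)) + (c : ℂ) • toL2 (reC f))).re +
      (inner ℂ (toL2 (imC f)) (negLap (toL2 (imC f)) + (c : ℂ) • toL2 (imC f))).re := by
  have h1 := (hasSum_form c hf.1).add (hasSum_form c (star_mem_Hs hf).1)
  have h2 := (((hasSum_form c (reC_mem_Hs hf).1).add (hasSum_form c (imC_mem_Hs hf).1))).mul_left 2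
  rw [form_star c hf] at h1
  have h3 := h1.unique (h2.congr_fun fun m => ?_)
  · linarith
  rw [contL2_star_eq, contL2_eq_re_add_im, coef_add, coef_sub, coef_smul]
  have := parallelogram_law_with_norm ℂ (coef (toL2 (reC f)) m)
    (Complex.I * coef (toL2 (imC f)) m)
  rw [norm_mul, Complex.norm_I, one_mul] at this
  linear_combination (4 * Real.pi ^ 2) * (freqSq m + c) * this

/-- Second variation in complex directions tangent to the constraint. -/
lemma IsPeriodicMinimizer.second_variation {c : ℝ} {φ : C(Torus, ℝ)}
    (h : IsPeriodicMinimizer c φ) {u : L2} (hu : u ∈ Hs 2) (h0 : inner ℂ (toL2 (φ ^ 2)) u = 0) :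
    0 ≤ (inner ℂ u (negLap u + ((c : ℂ) • u - (2 : ℂ) • mulBy φ u))).re := by
  obtain ⟨f, rfl⟩ := exists_contL2_eq hu.1
  have hi : ∫ z, (((φ z ^ 2 : ℝ) : ℂ) * f z) = 0 := by
    rw [← h0, toL2_eq, inner_contL2]
    refine integral_congr_ae (Eventually.of_forall fun z => ?_)
    simp [mul_comm]
  have hint : Integrable (fun z => ((φ z ^ 2 : ℝ) : ℂ) * f z) (volume : Measure Torus) :=
    integrable_of_continuous (by fun_prop)
  have hre : ∫ z, φ z ^ 2 * reC f z = 0 := by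
    have := integral_re hint
    rw [hi] at this
    simp only [RCLike.re_to_complex, Complex.re_ofReal_mul, Complex.zero_re] at this
    exact this
  have him : ∫ z, φ z ^ 2 * imC f z = 0 := by
    have := integral_im hint
    rw [hi] at this
    simp only [RCLike.im_to_complex, Complex.im_ofReal_mul, Complex.zero_im] at this
    exact this
  have v1 := h.second_variation_real (reC_mem_Hs hu) hre
  have v2 := h.second_variation_real (imC_mem_Hs hu) him
  have e1 : (inner ℂ (contL2 f) ((2 : ℂ) • mulBy φ (contL2 f))).re =
      2 * (∫ z, φ z * reC f z ^ 2) + 2 * ∫ z, φ z * imC f z ^ 2 := by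
    rw [mulBy_contL2, inner_smul_right, inner_contL2, ← mul_add, ← integral_add
      (integrable_of_continuous (by fun_prop)) (integrable_of_continuous (by fun_prop))]
    have : ∀ z, (ofRealC φ * f) z * conj (f z) =
        ((φ z * reC f z ^ 2 + φ z * imC f z ^ 2 : ℝ) : ℂ) := by
      intro z
      rw [ContinuousMap.mul_apply, ofRealC_apply, mul_assoc, Complex.mul_conj,
        Complex.normSq_apply, ← Complex.ofReal_mul]
      congr 1
      change φ z * _ = φ z * (f z).re ^ 2 + φ z * (f z).im ^ 2
      ring
    simp only [this]
    rw [integral_complex_ofReal, show (2 : ℂ) = ((2 : ℝ) : ℂ) by norm_num, ← Complex.ofReal_mul,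
      Complex.ofReal_re]
  rw [← add_sub_assoc, inner_sub_right, Complex.sub_re, e1, form_eq_re_add_im c hu]
  linarith

/-! ### Compact symmetric operators -/

/-- The inequality is a closed condition and the span of the eigenspaces is dense. On a finite sum
of eigenvectors, orthogonality reduces it to `κ μ² ≤ μ` for each eigenvalue. -/
lemma isCompact_symmetric_le {H : Type*} [NormedAddCommGroup H] [InnerProductSpace ℂ H]
    [CompleteSpace H] {S : H →L[ℂ] H} (hS : IsCompactOperator S)
    (hsymm : (S : H →ₗ[ℂ] H).IsSymmetric) {κ : ℝ}
    (hκ : ∀ μ : ℝ, Module.End.HasEigenvalue (S : H →ₗ[ℂ] H) (μ : ℂ) → κ * μ ^ 2 ≤ μ) (g : H) :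
    κ * ‖S g‖ ^ 2 ≤ (inner ℂ (S g) g).re := by
  have hclosed : IsClosed {g : H | κ * ‖S g‖ ^ 2 ≤ (inner ℂ (S g) g).re} :=
    isClosed_le (by fun_prop) (by fun_prop)
  have hdense : (⨆ μ, Module.End.eigenspace (S : H →ₗ[ℂ] H) μ).topologicalClosure = ⊤ :=
    (Submodule.topologicalClosure_eq_top_iff).2
      (ContinuousLinearMap.orthogonalComplement_iSup_eigenspaces_eq_bot hS hsymm)
  have hg : g ∈ closure ((⨆ μ, Module.End.eigenspace (S : H →ₗ[ℂ] H) μ : Submodule ℂ H) : Set H) := by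
    rw [← Submodule.topologicalClosure_coe, hdense]; trivial
  refine closure_minimal (fun g hg => ?_) hclosed hg
  obtain ⟨f, hf, rfl⟩ := (Submodule.mem_iSup_iff_exists_finsupp _ _).1 hg
  have hfam := hsymm.orthogonalFamily_eigenspaces
  have hSf : ∀ μ, S (f μ) = μ • f μ := fun μ => Module.End.mem_eigenspace_iff.1 (hf μ)
  have hsum : S (f.sum fun _ x => x) = ∑ μ ∈ f.support, μ • f μ := by
    rw [Finsupp.sum, map_sum]
    exact Finset.sum_congr rfl fun μ _ => hSf μ
  have i1 : inner ℂ (∑ μ ∈ f.support, μ • f μ) (∑ μ ∈ f.support, μ • f μ) =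
      ∑ μ ∈ f.support, inner ℂ (μ • f μ) (μ • f μ) := hfam.inner_sum (fun μ => μ • (⟨f μ, hf μ⟩ : Module.End.eigenspace (S : H →ₗ[ℂ] H) μ))
        (fun μ => μ • (⟨f μ, hf μ⟩ : Module.End.eigenspace (S : H →ₗ[ℂ] H) μ)) f.support
  have i2 : inner ℂ (∑ μ ∈ f.support, μ • f μ) (∑ μ ∈ f.support, f μ) =
      ∑ μ ∈ f.support, inner ℂ (μ • f μ) (f μ) := hfam.inner_sum (fun μ => μ • (⟨f μ, hf μ⟩ : Module.End.eigenspace (S : H →ₗ[ℂ] H) μ))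
        (fun μ => ⟨f μ, hf μ⟩) f.support
  rw [Set.mem_ofPred_eq, hsum, ← inner_self_eq_norm_sq (𝕜 := ℂ), Finsupp.sum, i1, i2,
    RCLike.re_to_complex, Complex.re_sum, Complex.re_sum, Finset.mul_sum]
  refine Finset.sum_le_sum fun μ hμ => ?_
  have hne : f μ ≠ 0 := Finsupp.mem_support_iff.1 hμ
  have hev : Module.End.HasEigenvalue (S : H →ₗ[ℂ] H) μ :=
    Module.End.hasEigenvalue_of_hasEigenvector ⟨hf μ, hne⟩
  have hreal : ((μ.re : ℝ) : ℂ) = μ := Complex.conj_eq_iff_re.1 (hsymm.conj_eigenvalue_eq_self hev)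
  obtain ⟨r, rfl⟩ : ∃ r : ℝ, (r : ℂ) = μ := ⟨μ.re, hreal⟩
  have e1 : (inner ℂ ((r : ℂ) • f r) ((r : ℂ) • f r)).re = r ^ 2 * ‖f r‖ ^ 2 := by
    rw [← RCLike.re_to_complex, inner_self_eq_norm_sq, norm_smul, Complex.norm_real, mul_pow,
      Real.norm_eq_abs, sq_abs]
  have e2 : (inner ℂ ((r : ℂ) • f r) (f r)).re = r * ‖f r‖ ^ 2 := by
    rw [inner_smul_left, Complex.conj_ofReal, Complex.re_ofReal_mul, ← RCLike.re_to_complex,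
      inner_self_eq_norm_sq]
  rw [e1, e2, ← mul_assoc]
  exact mul_le_mul_of_nonneg_right (hκ r hev) (sq_nonneg _)

/-! ### Fourier multipliers -/

lemma summable_multiplier {a : ℤ × ℤ → ℝ} {C : ℝ} (ha : ∀ m, |a m| ≤ C) (u : L2) :
    Summable fun m => ((a m : ℂ) * coef u m) • expoL2 m := by
  refine summable_expo (Summable.of_nonneg_of_le (fun m => by positivity) (fun m => ?_)
    ((summable_coef_sq u).mul_left (C ^ 2)))
  rw [norm_mul, mul_pow, Complex.norm_real, Real.norm_eq_abs]
  gcongr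
  exact ha m

/-- The Fourier multiplier with bounded real symbol `a`. -/
def multiplier (a : ℤ × ℤ → ℝ) (C : ℝ) (ha : ∀ m, |a m| ≤ C) : L2 →L[ℂ] L2 :=
  LinearMap.mkContinuous
    { toFun := fun u => ∑' m, ((a m : ℂ) * coef u m) • expoL2 m
      map_add' := fun u v => by
        rw [← (summable_multiplier ha u).tsum_add (summable_multiplier ha v)]
        refine tsum_congr fun m => ?_
        rw [coef_add, mul_add, add_smul]
      map_smul' := fun b u => by
        rw [RingHom.id_apply, ← (summable_multiplier ha u).tsum_const_smul b]
        refine tsum_congr fun m => ?_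
        rw [coef_smul, smul_smul, mul_left_comm] }
    C fun u => by
      have hC : 0 ≤ C := (abs_nonneg _).trans (ha 0)
      refine le_of_sq_le_sq ?_ (by positivity)
      rw [mul_pow]
      refine hasSum_le (fun m => ?_) (hasSum_norm_sq _) ((hasSum_norm_sq u).mul_left (C ^ 2))
      change _ * ‖coef (∑' m, ((a m : ℂ) * coef u m) • expoL2 m) m‖ ^ 2 ≤ _
      rw [coef_tsum (summable_multiplier ha u), norm_mul, mul_pow, Complex.norm_real,
        Real.norm_eq_abs, mul_left_comm]
      gcongr
      exact ha m

lemma coef_multiplier {a : ℤ × ℤ → ℝ} {C : ℝ} (ha : ∀ m, |a m| ≤ C) (u : L2) (m : ℤ × ℤ) :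
    coef (multiplier a C ha u) m = a m * coef u m := coef_tsum (summable_multiplier ha u) m

lemma norm_multiplier_le {a : ℤ × ℤ → ℝ} {C : ℝ} (ha : ∀ m, |a m| ≤ C) :
    ‖multiplier a C ha‖ ≤ C := LinearMap.mkContinuous_norm_le _ ((abs_nonneg _).trans (ha 0)) _

/-- A symbol with finite support gives a finite sum of rank-one operators. -/
lemma isCompactOperator_multiplier_of_finite {a : ℤ × ℤ → ℝ} {C : ℝ} (ha : ∀ m, |a m| ≤ C)
    (F : Finset (ℤ × ℤ)) (hF : ∀ m, m ∉ F → a m = 0) :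
    IsCompactOperator (multiplier a C ha) := by
  have h : multiplier a C ha = ∑ m ∈ F, (coefCLM m).smulRight ((a m : ℂ) • expoL2 m) := by
    ext1 u
    refine ext_coef fun n => ?_
    rw [coef_multiplier, sum_apply, ← coefCLM_apply n (∑ i ∈ F, _), map_sum]
    simp only [ContinuousLinearMap.smulRight_apply, map_smul, coefCLM_apply, coef_expoL2,
      smul_eq_mul]
    by_cases hn : n ∈ F
    · rw [Finset.sum_eq_single_of_mem n hn]
      · simp [mul_comm]
      · intro m _ hmn
        rw [if_neg hmn, mul_zero, mul_zero]
    · rw [hF n hn, Finset.sum_eq_zero]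
      · simp
      · intro m hm
        rw [if_neg (ne_of_mem_of_not_mem hm hn), mul_zero, mul_zero]
  rw [h]
  refine Submodule.sum_mem (compactOperator (RingHom.id ℂ) L2 L2) fun m _ => ?_
  have h1 : IsCompactOperator (ContinuousLinearMap.toSpanSingleton ℂ ((a m : ℂ) • expoL2 m)) :=
    isCompactOperator_of_locallyCompactSpace_rng
      (ContinuousLinearMap.toSpanSingleton ℂ ((a m : ℂ) • expoL2 m))
  exact h1.comp_clm (coefCLM m)

/-- The operator norm is bounded by the supremum of the symbol, so truncations to finite frequency
sets converge in norm, and compactness passes to the limit. -/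
lemma isCompactOperator_multiplier {a : ℤ × ℤ → ℝ} {C : ℝ} (ha : ∀ m, |a m| ≤ C)
    (h0 : Tendsto a cofinite (𝓝 0)) : IsCompactOperator (multiplier a C ha) := by
  classical
  have hC : 0 ≤ C := (abs_nonneg _).trans (ha 0)
  have hb : ∀ F : Finset (ℤ × ℤ), ∀ m, |if m ∈ F then a m else 0| ≤ C := by
    intro F m
    split_ifs
    · exact ha m
    · simpa using hC
  refine isCompactOperator_of_tendsto (l := atTop)
    (F := fun F : Finset (ℤ × ℤ) => multiplier _ C (hb F)) ?_ (Eventually.of_forall fun F =>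
      isCompactOperator_multiplier_of_finite (hb F) F fun m hm => if_neg hm)
  rw [Metric.tendsto_atTop]
  intro ε hε
  have hfin : {m | ¬ |a m| < ε / 2}.Finite := by
    have := h0.abs
    rw [abs_zero] at this
    exact this.eventually_lt_const (half_pos hε)
  refine ⟨hfin.toFinset, fun F hF => ?_⟩
  have hd : ∀ m, |(if m ∈ F then a m else 0) - a m| ≤ ε / 2 := by
    intro m
    split_ifs with hm
    · simpa using (half_pos hε).le
    · rw [zero_sub, abs_neg]
      by_contra hcon
      exact hm (hF (hfin.mem_toFinset.2 fun h => hcon h.le))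
  rw [dist_eq_norm]
  have he : multiplier _ C (hb F) - multiplier a C ha = multiplier _ (ε / 2) hd := by
    ext1 u
    refine ext_coef fun n => ?_
    rw [sub_apply, coef_sub, coef_multiplier, coef_multiplier,
      coef_multiplier, ← sub_mul]
    push_cast
    rfl
  rw [he]
  exact (norm_multiplier_le hd).trans_lt (half_lt_self hε)

/-! ### The symmetric sector in terms of Fourier coefficients -/

lemma mem_invariantUnder_iff_coef {σ : Torus → Torus}
    (hσ : MeasurePreserving σ (volume : Measure Torus) volume) (s : ℤ × ℤ ≃ ℤ × ℤ)
    (hs : ∀ m z, expo m (σ z) = expo (s m) z) (hneg : ∀ m, s (-m) = -s m) {u : L2} :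
    u ∈ invariantUnder σ hσ ↔ ∀ m, coef u (s m) = coef u m := by
  have hc : ∀ m, coef (Lp.compMeasurePreservingₗᵢ ℂ σ hσ u) (s m) = coef u m := by
    intro m
    unfold coef
    congr 1
    have hmap := integral_map (μ := (volume : Measure Torus)) (φ := σ)
      hσ.measurable.aemeasurable (f := fun z => expo (-m) z * u z)
      (by rw [hσ.map_eq]; exact (integrable_expo_mul _ u).aestronglyMeasurable)
    rw [hσ.map_eq] at hmap
    rw [hmap]
    refine integral_congr_ae ?_
    filter_upwards [Lp.coeFn_compMeasurePreserving u hσ] with z hz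
    rw [← hneg, ← hs]
    exact congrArg _ hz
  rw [mem_invariantUnder_iff]
  constructor
  · intro h m
    rw [← hc m, h]
  · intro h
    refine ext_coef fun m => ?_
    obtain ⟨n, rfl⟩ := s.surjective m
    rw [hc, h]

lemma mem_L2s_iff {u : L2} :
    u ∈ L2s ↔ ∀ m : ℤ × ℤ, coef u (-m.1, m.2) = coef u m ∧ coef u (m.1, -m.2) = coef u m := by
  have hx := mem_invariantUnder_iff_coef measurePreserving_reflX
    (Equiv.prodCongr (Equiv.neg ℤ) (Equiv.refl ℤ))
    (fun m z => by simp [expo, reflX, fourier_apply]) (fun m => by ext <;> simp) (u := u)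
  have hy := mem_invariantUnder_iff_coef measurePreserving_reflY
    (Equiv.prodCongr (Equiv.refl ℤ) (Equiv.neg ℤ))
    (fun m z => by simp [expo, reflY, fourier_apply]) (fun m => by ext <;> simp) (u := u)
  rw [L2s, Submodule.mem_inf, hx, hy, ← forall_and]
  rfl

/-- The symmetric sector is cut out by equalities of continuous functionals. Its completeness makes
it a Hilbert space in which the spectral theorem and the Neumann series are available. -/
lemma isClosed_L2s : IsClosed (L2s : Set L2) := by
  have : (L2s : Set L2) = ⋂ m : ℤ × ℤ, {u | coefCLM (-m.1, m.2) u = coefCLM m u} ∩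
      {u | coefCLM (m.1, -m.2) u = coefCLM m u} := by
    ext u
    simp only [SetLike.mem_coe, mem_L2s_iff, Set.mem_iInter, Set.mem_inter_iff, Set.mem_ofPred_eq,
      coefCLM_apply]
  rw [this]
  exact isClosed_iInter fun m => (isClosed_eq (ContinuousLinearMap.continuous _)
    (ContinuousLinearMap.continuous _)).inter (isClosed_eq (ContinuousLinearMap.continuous _)
    (ContinuousLinearMap.continuous _))

instance completeSpace_L2s : CompleteSpace L2s := isClosed_L2s.completeSpace_coe

lemma multiplier_mem_L2s {a : ℤ × ℤ → ℝ} {C : ℝ} (ha : ∀ m, |a m| ≤ C)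
    (hx : ∀ m : ℤ × ℤ, a (-m.1, m.2) = a m) (hy : ∀ m : ℤ × ℤ, a (m.1, -m.2) = a m)
    {u : L2} (hu : u ∈ L2s) : multiplier a C ha u ∈ L2s := by
  rw [mem_L2s_iff] at hu ⊢
  intro m
  simp only [coef_multiplier, hx, hy, (hu m).1, (hu m).2, and_self]

/-! ### The resolvent of the Laplacian -/

lemma abs_inv_freqSq_add_le {d : ℝ} (hd : 0 < d) (m : ℤ × ℤ) : |(freqSq m + d)⁻¹| ≤ d⁻¹ := by
  have := freqSq_nonneg m
  rw [abs_of_pos (by positivity)]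
  gcongr
  linarith

/-- The resolvent `(-Δ + d)⁻¹` on `L²`. -/
def resolventL2 (d : ℝ) (hd : 0 < d) : L2 →L[ℂ] L2 :=
  multiplier (fun m => (freqSq m + d)⁻¹) d⁻¹ (abs_inv_freqSq_add_le hd)

lemma coef_resolventL2 {d : ℝ} (hd : 0 < d) (u : L2) (m : ℤ × ℤ) :
    coef (resolventL2 d hd u) m = ((freqSq m + d)⁻¹ : ℝ) * coef u m := coef_multiplier _ u m

lemma isCompactOperator_resolventL2 {d : ℝ} (hd : 1 ≤ d) :
    IsCompactOperator (resolventL2 d (zero_lt_one.trans_le hd)) := by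
  refine isCompactOperator_multiplier _ ?_
  have h1 := summable_inv_freqSq.tendsto_cofinite_zero
  have h2 := (Real.continuous_sqrt.tendsto 0).comp h1
  rw [Real.sqrt_zero] at h2
  refine squeeze_zero (fun m => ?_) (fun m => ?_) h2
  · have := freqSq_nonneg m; positivity
  · have := freqSq_nonneg m
    rw [Function.comp_apply, ← inv_pow, Real.sqrt_sq (by positivity)]
    gcongr ?_⁻¹
    linarith

/-- With `d ≥ 1` the ratio `(1 + freqSq m) / (freqSq m + d)` is at most one, so the resolvent gains
two full derivatives. -/
lemma resolventL2_mem_Hper {d : ℝ} (hd : 1 ≤ d) (u : L2) :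
    resolventL2 d (zero_lt_one.trans_le hd) u ∈ Hper 2 := by
  refine mem_Hper.2 (Summable.of_nonneg_of_le (fun m => ?_) (fun m => ?_) (summable_coef_sq u))
  · have := freqSq_nonneg m; positivity
  · have := freqSq_nonneg m
    rw [coef_resolventL2, norm_mul, mul_pow, ← mul_assoc, ← mul_pow, Complex.norm_real,
      Real.norm_of_nonneg (by positivity)]
    refine mul_le_of_le_one_left (sq_nonneg _) (pow_le_one₀ (by positivity) ?_)
    rw [← div_eq_mul_inv, div_le_one (by positivity)]
    linarith

lemma negLap_resolventL2 {d : ℝ} (hd : 1 ≤ d) (u : L2) :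
    negLap (resolventL2 d (zero_lt_one.trans_le hd) u) +
      (d : ℂ) • resolventL2 d (zero_lt_one.trans_le hd) u = u := ext_coef fun m => by
  have := freqSq_nonneg m
  rw [coef_add, coef_smul, coef_negLap (resolventL2_mem_Hper hd u), coef_resolventL2, ← add_mul,
    ← mul_assoc, ← Complex.ofReal_add, ← Complex.ofReal_mul, mul_inv_cancel₀ (by linarith)]
  simp

lemma resolventL2_negLap {d : ℝ} (hd : 0 < d) {u : L2} (hu : u ∈ Hper 2) :
    resolventL2 d hd (negLap u + (d : ℂ) • u) = u := ext_coef fun m => by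
  have := freqSq_nonneg m
  rw [coef_resolventL2, coef_add, coef_smul, coef_negLap hu, ← add_mul,
    ← mul_assoc, ← Complex.ofReal_add, ← Complex.ofReal_mul, inv_mul_cancel₀ (by linarith)]
  simp

lemma inner_resolventL2 {d : ℝ} (hd : 0 < d) (u v : L2) :
    inner ℂ (resolventL2 d hd u) v = inner ℂ u (resolventL2 d hd v) := by
  refine (hasSum_inner _ _).unique ((hasSum_inner _ _).congr_fun fun m => ?_)
  rw [coef_resolventL2, coef_resolventL2, map_mul, Complex.conj_ofReal]
  ring

lemma resolventL2_mem_L2s {d : ℝ} (hd : 0 < d) : ∀ u ∈ L2s, resolventL2 d hd u ∈ L2s :=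
  fun _ hu => multiplier_mem_L2s _ (fun m => by simp [freqSq]) (fun m => by simp [freqSq]) hu

/-- The resolvent `(-Δ + d)⁻¹` on `L²_{per,s}`. -/
def resolventL2s (d : ℝ) (hd : 0 < d) : L2s →L[ℂ] L2s :=
  (resolventL2 d hd).restrict (resolventL2_mem_L2s hd)

lemma coe_resolventL2s {d : ℝ} (hd : 0 < d) (u : L2s) :
    (resolventL2s d hd u : L2) = resolventL2 d hd u := rfl

lemma norm_resolventL2s_le {d : ℝ} (hd : 0 < d) : ‖resolventL2s d hd‖ ≤ d⁻¹ := by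
  refine ContinuousLinearMap.opNorm_le_bound _ (by positivity) fun u => ?_
  exact ((resolventL2 d hd).le_opNorm (u : L2)).trans
    (mul_le_mul_of_nonneg_right (norm_multiplier_le _) (norm_nonneg _))

lemma isCompactOperator_resolventL2s {d : ℝ} (hd : 1 ≤ d) :
    IsCompactOperator (resolventL2s d (zero_lt_one.trans_le hd)) :=
  IsCompactOperator.restrict' (f := (resolventL2 d (zero_lt_one.trans_le hd) : L2 →ₗ[ℂ] L2))
    (isCompactOperator_resolventL2 hd) (resolventL2_mem_L2s _)

/-! ### Multiplication operators -/

lemma norm_mulBy_le (φ : C(Torus, ℝ)) (u : L2) : ‖mulBy φ u‖ ≤ ‖φ‖ * ‖u‖ := by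
  refine Lp.norm_le_mul_norm_of_ae_le_mul ?_
  filter_upwards [coeFn_mulBy φ u] with z hz
  rw [hz, norm_mul, Complex.norm_real]
  exact mul_le_mul_of_nonneg_right (φ.norm_coe_le_norm z) (norm_nonneg _)

lemma inner_mulBy (φ : C(Torus, ℝ)) (u v : L2) :
    inner ℂ (mulBy φ u) v = inner ℂ u (mulBy φ v) := by
  rw [L2.inner_def, L2.inner_def]
  refine integral_congr_ae ?_
  filter_upwards [coeFn_mulBy φ u, coeFn_mulBy φ v] with z h1 h2
  rw [h1, h2, RCLike.inner_apply, RCLike.inner_apply, map_mul, Complex.conj_ofReal]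
  ring

lemma mulBy_mem_L2s {φ : C(Torus, ℝ)} (hφ : toL2 φ ∈ L2s) {u : L2} (hu : u ∈ L2s) :
    mulBy φ u ∈ L2s :=
  ⟨mulBy_mem_invariantUnder _ hφ.1 hu.1, mulBy_mem_invariantUnder _ hφ.2 hu.2⟩

/-- Multiplication by `a φ` on `L²_{per,s}`. -/
def potential (a : ℝ) (φ : C(Torus, ℝ)) (hφ : toL2 φ ∈ L2s) : L2s →L[ℂ] L2s :=
  LinearMap.mkContinuous ((a : ℂ) • (mulBy φ).restrict fun _ hu => mulBy_mem_L2s hφ hu)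
    (|a| * ‖φ‖) fun u => by
      rw [LinearMap.smul_apply, norm_smul, Complex.norm_real, Real.norm_eq_abs, mul_assoc]
      exact mul_le_mul_of_nonneg_left (norm_mulBy_le φ u) (abs_nonneg a)

lemma coe_potential (a : ℝ) (φ : C(Torus, ℝ)) (hφ : toL2 φ ∈ L2s) (u : L2s) :
    (potential a φ hφ u : L2) = (a : ℂ) • mulBy φ u := rfl

lemma norm_potential_le (a : ℝ) (φ : C(Torus, ℝ)) (hφ : toL2 φ ∈ L2s) :
    ‖potential a φ hφ‖ ≤ |a| * ‖φ‖ := LinearMap.mkContinuous_norm_le _ (by positivity) _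

lemma inner_potential (a : ℝ) (φ : C(Torus, ℝ)) (hφ : toL2 φ ∈ L2s) (u v : L2s) :
    inner ℂ (potential a φ hφ u) v = inner ℂ u (potential a φ hφ v) := by
  rw [Submodule.coe_inner, Submodule.coe_inner, coe_potential, coe_potential, inner_smul_left,
    inner_smul_right, inner_mulBy, Complex.conj_ofReal]

/-! ### Existence of a negative eigenvalue -/

/-- If the form of `-Δ + c - a φ` takes a negative value, then there is a negative eigenvalue. -/
lemma exists_neg_eigenspace_ne_bot {c a : ℝ} (hc : 0 < c) {φ : C(Torus, ℝ)}
    (hφ : toL2 φ ∈ L2s) {ψ : L2} (hψ : ψ ∈ Hs 2)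
    (hneg : (inner ℂ ψ (negLap ψ + ((c : ℂ) • ψ - (a : ℂ) • mulBy φ ψ))).re < 0) :
    ∃ μ < 0, eigenspace (schrodinger c a φ hφ) μ ≠ ⊥ := by
  by_contra! hno
  -- The shift exceeds the norm of the potential, so `‖M T‖ ≤ |a| ‖φ‖ / (c + κ) < 1`; the added `1`
  -- also ensures `c + κ ≥ 1`.
  set κ : ℝ := |a| * ‖φ‖ + 1 with hκ
  have hκpos : 0 < κ := by positivity
  have hκ1 : 1 ≤ κ := by
    have : 0 ≤ |a| * ‖φ‖ := by positivity
    linarith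
  have hd : 1 ≤ c + κ := by linarith
  have hd0 : 0 < c + κ := zero_lt_one.trans_le hd
  set T := resolventL2s (c + κ) hd0 with hT
  set M := potential a φ hφ with hM
  have hMT : ‖M * T‖ < 1 := by
    calc ‖M * T‖ ≤ ‖M‖ * ‖T‖ := ContinuousLinearMap.opNorm_comp_le M T
      _ ≤ (|a| * ‖φ‖) * (c + κ)⁻¹ := by
        gcongr
        · exact norm_potential_le a φ hφ
        · exact norm_resolventL2s_le hd0
      _ < 1 := by
        rw [← div_eq_mul_inv, div_lt_one hd0]
        linarith
  -- The shifted operator factors as `-Δ + c + κ - aφ = (1 - M T)(-Δ + c + κ)`, so its inverse is `T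
  -- U⁻¹`, called `S` below.
  set U : (L2s →L[ℂ] L2s)ˣ := Units.oneSub (M * T) hMT with hU
  have hU1 : ∀ x : L2s, (U : L2s →L[ℂ] L2s) x = x - M (T x) := fun x => rfl
  have hU2 : ∀ x : L2s, (↑U⁻¹ : L2s →L[ℂ] L2s) ((U : L2s →L[ℂ] L2s) x) = x := fun x => by
    exact congrArg (fun A : L2s →L[ℂ] L2s => A x) U.inv_mul
  have hU3 : ∀ x : L2s, (U : L2s →L[ℂ] L2s) ((↑U⁻¹ : L2s →L[ℂ] L2s) x) = x := fun x => by
    exact congrArg (fun A : L2s →L[ℂ] L2s => A x) U.mul_inv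
  set S : L2s →L[ℂ] L2s := T * (↑U⁻¹ : L2s →L[ℂ] L2s) with hS
  have hSU : ∀ x : L2s, S ((U : L2s →L[ℂ] L2s) x) = T x := fun x => by
    change T ((↑U⁻¹ : L2s →L[ℂ] L2s) ((U : L2s →L[ℂ] L2s) x)) = T x
    rw [hU2]
  have hTsymm : ∀ x y : L2s, inner ℂ (T x) y = inner ℂ x (T y) := fun x y =>
    inner_resolventL2 hd0 x y
  have hScomp : IsCompactOperator S :=
    (isCompactOperator_resolventL2s hd).comp_clm (↑U⁻¹ : L2s →L[ℂ] L2s)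
  have hSsymm : (S : L2s →ₗ[ℂ] L2s).IsSymmetric := by
    intro x y
    -- Writing both arguments as images of `U` removes the inverse: the claim becomes `(T x, y - M T
    -- y) = (x - M T x, T y)`.
    obtain ⟨x, rfl⟩ : ∃ x', (U : L2s →L[ℂ] L2s) x' = x := ⟨_, hU3 x⟩
    obtain ⟨y, rfl⟩ : ∃ y', (U : L2s →L[ℂ] L2s) y' = y := ⟨_, hU3 y⟩
    change inner ℂ (S _) _ = inner ℂ _ (S _)
    rw [hSU, hSU, hU1, hU1, inner_sub_left, inner_sub_right, hTsymm, inner_potential]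
  have hev : ∀ μ : ℝ, Module.End.HasEigenvalue (S : L2s →ₗ[ℂ] L2s) (μ : ℂ) → κ * μ ^ 2 ≤ μ := by
    intro μ hμ
    rcases eq_or_ne μ 0 with rfl | hμ0
    · simp
    obtain ⟨w, hw, hw0⟩ := hμ.exists_hasEigenvector
    have hSw : S w = (μ : ℂ) • w := Module.End.mem_eigenspace_iff.1 hw
    obtain ⟨x, rfl⟩ : ∃ x', (U : L2s →L[ℂ] L2s) x' = w := ⟨_, hU3 w⟩
    set w : L2s := (U : L2s →L[ℂ] L2s) x with hwdef
    rw [hSU] at hSw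
    have hμC : (μ : ℂ) ≠ 0 := by exact_mod_cast hμ0
    have hwT : w = (μ : ℂ)⁻¹ • T x := by rw [hSw, smul_smul, inv_mul_cancel₀ hμC, one_smul]
    have hwH : (w : L2) ∈ Hper 2 := by
      rw [hwT]
      exact Submodule.smul_mem _ _ (resolventL2_mem_Hper hd (x : L2))
    have hx : (x : L2) = (μ : ℂ) • negLap (w : L2) + ((c + κ : ℝ) : ℂ) • (μ : ℂ) • (w : L2) := by
      have h1 := negLap_resolventL2 hd (x : L2)
      rw [← coe_resolventL2s, ← hT, hSw, Submodule.coe_smul, negLap_smul _ hwH] at h1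
      exact h1.symm
    have hw2 : (w : L2) = x - (a : ℂ) • mulBy φ ((μ : ℂ) • (w : L2)) := by
      have h1 : (w : L2) = x - M (T x) := congrArg Subtype.val (hU1 x)
      rw [hSw, coe_potential] at h1
      exact h1
    by_contra hlt
    -- An eigenvalue `μ ≠ 0` of `S` corresponds to the eigenvalue `μ⁻¹ - κ` of the original
    -- operator. If that were nonnegative, then `μ > 0` and `κ μ ≤ 1`, so `κ μ² ≤ μ`.
    have hneg' : μ⁻¹ - κ < 0 := by
      by_contra hge
      push Not at hge
      have h1 : 0 < μ⁻¹ := by linarith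
      have h2 : 0 < μ := inv_pos.1 h1
      have h3 : κ * μ ≤ 1 := by
        have := mul_le_mul_of_nonneg_right (sub_nonneg.1 hge) h2.le
        rwa [inv_mul_cancel₀ hμ0] at this
      nlinarith
    have hmem : w ∈ eigenspace (schrodinger c a φ hφ) (μ⁻¹ - κ) := by
      rw [mem_eigenspace]
      refine ⟨⟨hwH, w.2⟩, Subtype.ext ?_⟩
      rw [schrodinger_apply]
      change negLap (w : L2) + ((c : ℂ) • (w : L2) - (a : ℂ) • mulBy φ (w : L2)) =
        ((μ⁻¹ - κ : ℝ) : ℂ) • (w : L2)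
      rw [hx, map_smul] at hw2
      have h1 : (μ : ℂ) • (negLap (w : L2) + ((c : ℂ) • (w : L2) - (a : ℂ) • mulBy φ (w : L2))) =
          (w : L2) - ((κ : ℂ) * μ) • (w : L2) := by
        nth_rewrite 4 [hw2]
        push_cast
        module
      have h2 : ((μ⁻¹ - κ : ℝ) : ℂ) • (w : L2) =
          (μ : ℂ)⁻¹ • ((w : L2) - ((κ : ℂ) * μ) • (w : L2)) := by
        rw [smul_sub, smul_smul, ← sub_smul]
        congr 1
        push_cast
        field_simp
      rw [h2, ← h1, smul_smul, inv_mul_cancel₀ hμC, one_smul]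
    rw [hno _ hneg'] at hmem
    exact hw0 ((Submodule.mem_bot ℂ).1 hmem)
  have hψ2 : negLap ψ + ((c + κ : ℝ) : ℂ) • ψ ∈ L2s :=
    add_mem (negLap_mem_L2s hψ) (Submodule.smul_mem _ _ hψ.2)
  set x : L2s := ⟨_, hψ2⟩ with hx
  have hTx : T x = ⟨ψ, hψ.2⟩ := Subtype.ext (resolventL2_negLap hd0 hψ.1)
  -- Here `U x` is the shifted operator applied to `ψ`, so `S (U x) = ψ`. The bound reads `κ ‖ψ‖² ≤
  -- form + κ ‖ψ‖²`, against the negativity of the form.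
  have hmain := isCompact_symmetric_le hScomp hSsymm hev ((U : L2s →L[ℂ] L2s) x)
  rw [hSU, hU1, hTx, Submodule.coe_inner] at hmain
  change κ * ‖ψ‖ ^ 2 ≤ (inner ℂ ψ (negLap ψ + ((c + κ : ℝ) : ℂ) • ψ - (a : ℂ) • mulBy φ ψ)).re
    at hmain
  have hsplit : negLap ψ + ((c + κ : ℝ) : ℂ) • ψ - (a : ℂ) • mulBy φ ψ =
      (negLap ψ + ((c : ℂ) • ψ - (a : ℂ) • mulBy φ ψ)) + (κ : ℂ) • ψ := by
    push_cast
    module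
  rw [hsplit, inner_add_right, Complex.add_re, inner_smul_right, Complex.re_ofReal_mul,
    ← RCLike.re_to_complex (x := inner ℂ ψ ψ), inner_self_eq_norm_sq] at hmain
  linarith

/-! ### Counting negative eigenvalues -/

section Counting

variable {E : Type*} [NormedAddCommGroup E] [InnerProductSpace ℂ E]

lemma exists_mem_domain_sum (A : E →ₗ.[ℂ] E) {ι : Type*} (s : Finset ι) (μ : ι → ℝ) (f : ι → E)
    (hf : ∀ i, f i ∈ eigenspace A (μ i)) :
    ∃ h : ∑ i ∈ s, f i ∈ A.domain, A ⟨_, h⟩ = ∑ i ∈ s, (μ i : ℂ) • f i := by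
  classical
  choose hd he using fun i => (mem_eigenspace A (μ i) (f i)).1 (hf i)
  refine ⟨Submodule.sum_mem _ fun i _ => hd i, ?_⟩
  have h1 : (⟨∑ i ∈ s, f i, Submodule.sum_mem _ fun i _ => hd i⟩ : A.domain) =
      ∑ i ∈ s, ⟨f i, hd i⟩ := Subtype.ext (by simp)
  rw [h1]
  change A.toFun _ = _
  rw [map_sum]
  exact Finset.sum_congr rfl fun i _ => he i

/-- A symmetric operator is negative definite on the span of its eigenvectors with negative
eigenvalue. -/
lemma form_neg_of_mem_iSup {A : E →ₗ.[ℂ] E}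
    (hA : ∀ x y : A.domain, inner ℂ (A x) (y : E) = inner ℂ (x : E) (A y)) {w : E}
    (hw : w ∈ (⨆ μ : {μ : ℝ // μ < 0}, eigenspace A (μ : ℝ) : Submodule ℂ E)) (hw0 : w ≠ 0) :
    ∃ h : w ∈ A.domain, (inner ℂ w (A ⟨w, h⟩)).re < 0 := by
  obtain ⟨f, hf, rfl⟩ := (Submodule.mem_iSup_iff_exists_finsupp _ _).1 hw
  obtain ⟨h, hA2⟩ := exists_mem_domain_sum A f.support (fun μ => (μ : ℝ)) f hf
  refine ⟨h, ?_⟩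
  change (inner ℂ (∑ μ ∈ f.support, f μ) (A ⟨∑ μ ∈ f.support, f μ, h⟩)).re < 0
  -- Eigenvectors for distinct eigenvalues are orthogonal by symmetry, so the form is a sum of terms
  -- `μ ‖f μ‖²`.
  have horth : ∀ μ ν : {μ : ℝ // μ < 0}, μ ≠ ν → inner ℂ (f μ) (f ν) = 0 := by
    intro μ ν hne
    obtain ⟨h1, e1⟩ := (mem_eigenspace A _ _).1 (hf μ)
    obtain ⟨h2, e2⟩ := (mem_eigenspace A _ _).1 (hf ν)
    have h3 := hA ⟨f μ, h1⟩ ⟨f ν, h2⟩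
    rw [e1, e2, inner_smul_left, inner_smul_right, Complex.conj_ofReal, ← sub_eq_zero,
      ← sub_mul] at h3
    refine (mul_eq_zero.1 h3).resolve_left fun h4 => hne (Subtype.ext ?_)
    exact_mod_cast sub_eq_zero.1 h4
  have hsum : (inner ℂ (∑ μ ∈ f.support, f μ) (A ⟨∑ μ ∈ f.support, f μ, h⟩)).re =
      ∑ μ ∈ f.support, (μ : ℝ) * ‖f μ‖ ^ 2 := by
    rw [hA2, sum_inner, Complex.re_sum]
    refine Finset.sum_congr rfl fun μ hμ => ?_
    rw [inner_sum, Finset.sum_eq_single_of_mem μ hμ, inner_smul_right, Complex.re_ofReal_mul,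
      ← RCLike.re_to_complex, inner_self_eq_norm_sq]
    intro ν _ hne
    rw [inner_smul_right, horth μ ν hne.symm, mul_zero]
  rw [hsum]
  have hne : f.support.Nonempty := by
    rw [Finsupp.support_nonempty_iff]
    rintro rfl
    exact hw0 (by simp)
  refine Finset.sum_neg (fun μ hμ => mul_neg_of_neg_of_pos μ.2 ?_) hne
  have := norm_pos_iff.2 (Finsupp.mem_support_iff.1 hμ)
  positivity

/-- If the form of a symmetric operator is nonnegative on the kernel of a linear functional, then
there is at most one negative eigenvalue. -/
lemma negCount_le_one {E : Type} [NormedAddCommGroup E] [InnerProductSpace ℂ E] {A : E →ₗ.[ℂ] E}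
    (hA : ∀ x y : A.domain, inner ℂ (A x) (y : E) = inner ℂ (x : E) (A y)) (l : E →ₗ[ℂ] ℂ)
    (hl : ∀ x : A.domain, l x = 0 → 0 ≤ (inner ℂ (x : E) (A x)).re) : negCount A ≤ 1 := by
  unfold negCount
  rw [← CommSemiring.rank_self ℂ]
  -- The functional is injective on the span: a nonzero vector there annihilated by `l` would have a
  -- form both negative and nonnegative.
  refine LinearMap.rank_le_of_injective (l.comp (Submodule.subtype _)) ?_
  rw [← LinearMap.ker_eq_bot, LinearMap.ker_eq_bot']
  rintro ⟨w, hw⟩ hw0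
  by_contra hne
  obtain ⟨h, hlt⟩ := form_neg_of_mem_iSup hA hw fun h => hne (Subtype.ext h)
  exact absurd (hl ⟨w, h⟩ hw0) (not_le.2 hlt)

end Counting

lemma one_le_negCount {E : Type*} [AddCommGroup E] [Module ℂ E] {A : E →ₗ.[ℂ] E} {μ : ℝ}
    (hμ : μ < 0) (h : eigenspace A μ ≠ ⊥) : 1 ≤ negCount A := by
  obtain ⟨w, hw, hw0⟩ := Submodule.exists_mem_ne_zero_of_ne_bot h
  have hw2 : w ∈ (⨆ μ : {μ : ℝ // μ < 0}, eigenspace A (μ : ℝ) : Submodule ℂ E) :=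
    Submodule.mem_iSup_of_mem ⟨μ, hμ⟩ hw
  rw [Cardinal.one_le_iff_pos, negCount, rank_pos_iff_exists_ne_zero]
  exact ⟨⟨w, hw2⟩, fun h => hw0 (congrArg Subtype.val h)⟩

/-- An eigenvector of the block operator is a pair of solutions for the same eigenvalue. For a
negative eigenvalue the second component vanishes, leaving a copy of the eigenspace of `A`. -/
lemma negCount_blockDiag {E F : Type} [AddCommGroup E] [Module ℂ E] [AddCommGroup F] [Module ℂ F]
    (A : E →ₗ.[ℂ] E) {B : F →ₗ.[ℂ] F} (hB : ∀ μ < 0, eigenspace B μ = ⊥) :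
    negCount (blockDiag A B) = negCount A := by
  have h : ∀ μ : {μ : ℝ // μ < 0}, eigenspace (blockDiag A B) (μ : ℝ) =
      (eigenspace A (μ : ℝ)).map (LinearMap.inl ℂ E F) := by
    rintro ⟨μ, hμ⟩
    ext ⟨x, y⟩
    rw [mem_eigenspace, Submodule.mem_map]
    constructor
    · rintro ⟨⟨h1, h2⟩, h3⟩
      rw [blockDiag_apply] at h3
      have hy : y ∈ eigenspace B μ := (mem_eigenspace B μ y).2 ⟨h2, congrArg Prod.snd h3⟩
      rw [hB μ hμ, Submodule.mem_bot] at hy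
      subst hy
      exact ⟨x, (mem_eigenspace A μ x).2 ⟨h1, congrArg Prod.fst h3⟩, rfl⟩
    · rintro ⟨x', hx', he⟩
      obtain ⟨rfl, rfl⟩ := Prod.mk.inj he
      obtain ⟨h1, h2⟩ := (mem_eigenspace A μ _).1 hx'
      refine ⟨⟨h1, B.domain.zero_mem⟩, ?_⟩
      rw [blockDiag_apply]
      refine Prod.ext h2 ?_
      change B ⟨0, _⟩ = (μ : ℂ) • (0 : F)
      rw [smul_zero]
      exact B.map_zero
  rw [negCount, negCount, iSup_congr h, ← Submodule.map_iSup]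
  exact (Submodule.equivMapOfInjective _ LinearMap.inl_injective _).rank_eq.symm

/-! ### The linearized operators at a periodic minimizer -/

lemma schrodinger_symm (c a : ℝ) (φ : C(Torus, ℝ)) (hφ : toL2 φ ∈ L2s)
    (x y : (schrodinger c a φ hφ).domain) :
    inner ℂ (schrodinger c a φ hφ x) (y : L2s) = inner ℂ (x : L2s) (schrodinger c a φ hφ y) := by
  rw [Submodule.coe_inner, Submodule.coe_inner, schrodinger_apply, schrodinger_apply,
    inner_add_left, inner_add_right, negLap_symm (u := ((x : L2s) : L2)) (v := ((y : L2s) : L2)) x.2.1 y.2.1, inner_sub_left, inner_sub_right,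
    inner_smul_left, inner_smul_right, inner_smul_left, inner_smul_right, inner_mulBy,
    Complex.conj_ofReal, Complex.conj_ofReal]

lemma opL₁_apply (c : ℝ) (φ : C(Torus, ℝ)) (hφ : toL2 φ ∈ L2s) (u : (opL₁ c φ hφ).domain) :
    (opL₁ c φ hφ u : L2) =
      negLap (u : L2s) + ((c : ℂ) • ((u : L2s) : L2) - (2 : ℂ) • mulBy φ (u : L2s)) := by
  refine (schrodinger_apply c 2 φ hφ u).trans ?_
  rw [Complex.ofReal_ofNat]

lemma opL₂_apply (c : ℝ) (φ : C(Torus, ℝ)) (hφ : toL2 φ ∈ L2s) (u : (opL₂ c φ hφ).domain) :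
    (opL₂ c φ hφ u : L2) = negLap (u : L2s) + ((c : ℂ) • ((u : L2s) : L2) - mulBy φ (u : L2s)) := by
  refine (schrodinger_apply c 1 φ hφ u).trans ?_
  rw [Complex.ofReal_one, one_smul]

namespace IsPeriodicMinimizer

variable {c : ℝ} {φ : C(Torus, ℝ)}

lemma mulBy_self (φ : C(Torus, ℝ)) : mulBy φ (toL2 φ) = toL2 (φ ^ 2) := by
  rw [toL2_eq, mulBy_contL2, toL2_pow]

/-- The equation turns `𝓛₁ φ` into `-φ²`, so the form at `φ` is `-∫ φ³`. -/
lemma form_neg (h : IsPeriodicMinimizer c φ) :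
    (inner ℂ (toL2 φ) (negLap (toL2 φ) + ((c : ℂ) • toL2 φ -
      ((2 : ℝ) : ℂ) • mulBy φ (toL2 φ)))).re < 0 := by
  have e : negLap (toL2 φ) + ((c : ℂ) • toL2 φ - ((2 : ℝ) : ℂ) • mulBy φ (toL2 φ)) =
      -toL2 (φ ^ 2) := by
    rw [← add_sub_assoc, h.negLap_add_smul, mulBy_self]
    push_cast
    module
  rw [e, inner_neg_right, inner_toL2, Complex.neg_re, Complex.ofReal_re]
  refine neg_lt_zero.2 (integral_pos_of_continuous (by fun_prop) fun z => ?_)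
  have := h.pos z
  exact mul_pos this (pow_pos this 2)

lemma form_nonneg (h : IsPeriodicMinimizer c φ) {u : L2} (hu : u ∈ Hper 2) :
    0 ≤ (inner ℂ u (negLap u + ((c : ℂ) • u - mulBy φ u))).re := by
  obtain ⟨f, rfl⟩ := exists_contL2_eq hu
  obtain ⟨δ, hδ, hφ⟩ := exists_pos_le h.pos
  have hne : ∀ z, (φ z : ℂ) ≠ 0 := fun z => by exact_mod_cast (h.pos z).ne'
  -- At the zero mode the lower bound is `0`, since `freqSq 0 = 0`.
  have := h.quadratic_le hδ hφ (v := ⟨fun z => f z / φ z,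
    f.continuous.div (Complex.continuous_ofReal.comp φ.continuous) hne⟩) (fun z => rfl) hu 0
  simpa [freqSq] using this

lemma negCount_opL₁ (h : IsPeriodicMinimizer c φ) (hc : 0 < c) :
    negCount (opL₁ c φ h.mem_L2s) = 1 := by
  refine le_antisymm ?_ ?_
  -- The functional is the pairing with `φ²`, whose kernel is the tangent space to the constraint at
  -- `φ`.
  · refine negCount_le_one (schrodinger_symm c 2 φ h.mem_L2s)
      ((innerSL ℂ (toL2 (φ ^ 2)) : L2 →ₗ[ℂ] ℂ).comp L2s.subtype) fun x hx => ?_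
    rw [Submodule.coe_inner, opL₁_apply]
    have := h.second_variation (u := ((x : L2s) : L2)) x.2 hx
    exact this
  · obtain ⟨μ, hμ, hne⟩ := exists_neg_eigenspace_ne_bot hc h.mem_L2s h.mem_Hs h.form_neg
    exact one_le_negCount hμ hne

lemma eigenspace_opL₂_neg (h : IsPeriodicMinimizer c φ) {μ : ℝ} (hμ : μ < 0) :
    eigenspace (opL₂ c φ h.mem_L2s) μ = ⊥ := by
  rw [Submodule.eq_bot_iff]
  intro u hu
  obtain ⟨hd, he⟩ := (mem_eigenspace _ _ _).1 hu
  have he2 := congrArg Subtype.val he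
  rw [opL₂_apply] at he2
  have h1 := h.form_nonneg (u := (u : L2)) hd.1
  change negLap (u : L2) + ((c : ℂ) • (u : L2) - mulBy φ (u : L2)) = (μ : ℂ) • (u : L2) at he2
  rw [he2, inner_smul_right, Complex.re_ofReal_mul, ← RCLike.re_to_complex,
    inner_self_eq_norm_sq] at h1
  by_contra hne
  have : 0 < ‖(u : L2)‖ := norm_pos_iff.2 fun h => hne (Subtype.ext h)
  nlinarith [mul_pos_of_neg_of_neg hμ (neg_lt_zero.2 (pow_pos this 2))]

/-- A kernel element has vanishing form, and `eq_smul` makes it a multiple of `φ`; conversely `𝓛₂ φ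
= 0` is the equation itself. -/
lemma eigenspace_opL₂_zero (h : IsPeriodicMinimizer c φ) :
    eigenspace (opL₂ c φ h.mem_L2s) 0 = Submodule.span ℂ {⟨toL2 φ, h.mem_L2s⟩} := by
  ext u
  rw [mem_eigenspace, Submodule.mem_span_singleton]
  constructor
  · rintro ⟨hd, he⟩
    have he2 := congrArg Subtype.val he
    rw [opL₂_apply, Complex.ofReal_zero, zero_smul] at he2
    change negLap (u : L2) + ((c : ℂ) • (u : L2) - mulBy φ (u : L2)) = 0 at he2
    obtain ⟨a, ha⟩ := h.eq_smul (u := (u : L2)) hd.1 (by rw [he2, inner_zero_right]; simp)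
    exact ⟨a, Subtype.ext ha.symm⟩
  · rintro ⟨a, rfl⟩
    have hmem : (⟨toL2 φ, h.mem_L2s⟩ : L2s) ∈ eigenspace (opL₂ c φ h.mem_L2s) 0 := by
      rw [mem_eigenspace]
      refine ⟨h.mem_Hs, Subtype.ext ?_⟩
      rw [opL₂_apply, Complex.ofReal_zero, zero_smul]
      change negLap (toL2 φ) + ((c : ℂ) • toL2 φ - mulBy φ (toL2 φ)) = 0
      rw [mulBy_self, ← add_sub_assoc]
      exact h.equation
    exact (mem_eigenspace _ _ _).1 (Submodule.smul_mem _ a hmem)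

lemma toL2_ne_zero (h : IsPeriodicMinimizer c φ) : toL2 φ ≠ 0 := by
  intro h0
  have h1 := inner_toL2 φ φ
  rw [h0, inner_zero_left] at h1
  have h2 : 0 < ∫ z, φ z * φ z :=
    integral_pos_of_continuous (by fun_prop) fun z => mul_pos (h.pos z) (h.pos z)
  exact h2.ne (by exact_mod_cast h1)

end IsPeriodicMinimizer

end PeriodicNLS

end

theorem proposition2p5 (c : ℝ) (hc : 2 < c) (φ : C(Torus, ℝ)) (hφ : IsPeriodicMinimizer c φ) :
    negCount (opL₁ c φ hφ.mem_L2s) = 1 ∧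
    negCount (opL c φ hφ.mem_L2s) = 1 ∧
    negCount (opL₂ c φ hφ.mem_L2s) = 0 ∧
    kerDim (opL₂ c φ hφ.mem_L2s) = 1 ∧
    eigenspace (opL₂ c φ hφ.mem_L2s) 0 = Submodule.span ℂ {⟨toL2 φ, hφ.mem_L2s⟩} := by
  have h1 := hφ.negCount_opL₁ (zero_lt_two.trans hc)
  refine ⟨h1, ?_, ?_, ?_, hφ.eigenspace_opL₂_zero⟩
  · rw [opL, negCount_blockDiag _ fun μ hμ => hφ.eigenspace_opL₂_neg hμ, h1]
  · rw [negCount, iSup_congr fun μ : {μ : ℝ // μ < 0} => hφ.eigenspace_opL₂_neg μ.2, iSup_bot,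
      rank_bot]
  · rw [kerDim, hφ.eigenspace_opL₂_zero]
    exact Module.rank_eq_one_iff_finrank_eq_one.2 <|
      finrank_span_singleton fun h => hφ.toL2_ne_zero (congrArg Subtype.val h)
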